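/- Theorem 7 (SPNW). Let $\mathbb G$ be a directed graph with $V$ vertices, $E$ edges (at most one edge for each ordered pair of distinct vertices, no self-edges) and real, possibly negative, edge lengths; an undirected graph is treated as the directed graph with two opposite edges of equal length for each edge. Let $a$ be a source vertex and $0<\epsilon<1$. The graph is given by a black box that can be evaluated in quantum superposition: in the *matrix model* it returns, for vertices $i,j$, whether the edge $e_{ij}$ exists, and its length; in the *edge list model* the out-degree of each vertex is known, and the black box returns, for a vertex $i$ and an index $k$, the destination and the length of the $k$-th edge outgoing from $i$. Black-box calls, array accesses, arithmetic operations, and elementary quantum operations on a register (preparation of a start state, reflection about it, phase flip, measurement) cost one time step each. *SPNW* is the following algorithm. (1) In the edge list model, set up arrays $f[i]$ that list the sources and lengths of the edges into vertex $i$. (2) Set $\mathrm{dist}[a]=0$, $\mathrm{dist}[i]=\infty$ for $i\ne a$. (3) Repeat $V-1$ times: for each vertex $i$, use *minfind* with parameter $\epsilon'^{-1}=V^2\epsilon^{-1}$ to find a vertex $j$ such that $\mathrm{dist}[j]+\mathrm{length}(e_{ji})$ is minimal (with value $\infty$ if $e_{ji}$ does not exist), searching over all vertices in the matrix model and over $f[i]$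 in the edge list model (where vertices with empty $f[i]$ are skipped); if the value found is smaller than $\mathrm{dist}[i]$, replace $\mathrm{dist}[i]$ by it. (4) Repeat the body of the loop once more; return *false* if this changes $\mathrm{dist}$, and return $\mathrm{dist}$ otherwise. Here *minfind* starts with a uniformly random element $y$ of the domain and, as long as *findsol* with parameter $\epsilon'^{-1}$ finds an element with a smaller value than $y$, replaces $y$ by that element; it returns $y$ when *findsol* finds none. *findsol* runs the Boyer–Brassard–Høyer–Tapp search (stopped when $m>2\sqrt N$, with $\lambda=8/7$) at most twice, and then the search of Buhrman, Cleve, de Wolf and Zalka with parameter $\epsilon'^{-1}$, until a verified solution is found. In both models the following holds with probability at least $1-\epsilon$: if a cycle of negative total length can be reached from $a$, then *SPNW* returns *false*; otherwise it returns the array whose $i$-th element is the length of a shortest path from $a$ to vertex $i$, and $\infty$ if there is no such path. Moreover, if $\epsilon^{-1}$ is polynomially bounded in $V$, that is, $\epsilon^{-1}\le V^c$ for a fixed $c$, then for $V\ge 2$ the expected running time of *SPNW* is $O(\sqrt{V^5\lg V})$ in the matrix model, and, if $E\ge 1$, $O(\sqrt{V^3E\lg V})$ in the edge list model, with constants that depend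 only on $c$. -/

import Mathlib

open scoped ENNReal

noncomputable section

namespace QSP

/-! ## Unit-cost computations

Basic arithmetic on numbers, comparisons, reading or writing one array cell and one call of the
black box cost one step each.  Arrays are represented by functions (or by lists, for arrays that
grow); only the charged operations below access them. -/

/-- A deterministic computation: its result together with the number of its elementary steps.
It can also be evaluated in superposition (see `amplify`). -/
structure Timed (α : Type) where
  val : α
  time : ℕ

instance : Monad Timed where
  pure a := ⟨a, 0⟩
  bind x f := ⟨(f x.val).val, x.time + (f x.val).time⟩

/-- One elementary operation, with result `a`. -/
def Timed.op {α : Type} (a : α) : Timed α := ⟨a, 1⟩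

/-- `k` elementary operations, without result. -/
def Timed.ticks (k : ℕ) : Timed Unit := ⟨(), k⟩

/-- A quantum algorithm with classical control, given by the joint law of its outcome and of the
number of elementary steps that it performs.  All randomness comes from quantum measurements and
uniform random choices. -/
structure QProg (α : Type) where
  law : PMF (α × ℕ)

instance : Monad QProg where
  pure a := ⟨PMF.pure (a, 0)⟩
  bind x f := ⟨x.law.bind fun r => (f r.1).law.map fun s => (s.1, r.2 + s.2)⟩

namespace QProg

/-- Run a deterministic computation. -/
def run {α : Type} (t : Timed α) : QProg α := ⟨PMF.pure (t.val, t.time)⟩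

/-- The probability that the outcome lies in `A`. -/
def prob {α : Type} (p : QProg α) (A : Set α) : ℝ≥0∞ := p.law.toOuterMeasure {r | r.1 ∈ A}

/-- The expected number of elementary steps. -/
def expectedTime {α : Type} (p : QProg α) : ℝ≥0∞ := ∑' r : α × ℕ, p.law r * (r.2 : ℝ≥0∞)

/-- A uniformly random element of a finite nonempty type, in one step. -/
def uniform (ι : Type) [Fintype ι] [Nonempty ι] : QProg ι :=
  ⟨(PMF.uniformOfFintype ι).map fun x => (x, 1)⟩

/-- Try the algorithms of a list in turn until one of them returns a result. -/
def firstSome {α : Type} : List (QProg (Option α)) → QProg (Option α)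
  | [] => pure none
  | p :: ps => do
    match ← p with
    | some x => pure (some x)
    | none => firstSome ps

end QProg

/-! ## Quantum states, Grover iterations, measurement -/

section Quantum

variable {ι : Type} [Fintype ι]

/-- Pure states of a register with basis `ι`: unit vectors of `ℂ^ι`. -/
abbrev QState (ι : Type) [Fintype ι] : Type :=
  {ψ : EuclideanSpace ℂ ι // ‖ψ‖ = 1}

/-- Measurement in the computational basis: outcome `x` has probability `|ψ x|²`. -/
def measureState (ψ : QState ι) : PMF ι :=
  PMF.ofFintype (fun x => ENNReal.ofReal (‖ψ.1 x‖ ^ 2)) (by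
    rw [← ENNReal.ofReal_sum_of_nonneg (fun _ _ => by positivity),
      ← EuclideanSpace.norm_sq_eq, ψ.2]
    simp)

/-- The phase oracle of `P`: `|x⟩ ↦ -|x⟩` if `P x`, and `|x⟩ ↦ |x⟩` otherwise. -/
def phaseOracle (P : ι → Bool) : EuclideanSpace ℂ ι ≃ₗᵢ[ℂ] EuclideanSpace ℂ ι :=
  LinearIsometryEquiv.piLpCongrRight 2 fun x =>
    if P x = true then LinearIsometryEquiv.neg ℂ else LinearIsometryEquiv.refl ℂ ℂ

/-- One Grover iteration with start state `s`: the phase oracle, followed by the reflection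
`2|s⟩⟨s| - 1`. -/
def groverStep (s : QState ι) (P : ι → Bool) :
    EuclideanSpace ℂ ι ≃ₗᵢ[ℂ] EuclideanSpace ℂ ι :=
  (phaseOracle P).trans (Submodule.span ℂ {s.1}).reflection

/-- The state after `j` Grover iterations, started in `s`. -/
def groverState (s : QState ι) (P : ι → Bool) : ℕ → QState ι
  | 0 => s
  | j + 1 => ⟨groverStep s P (groverState s P j).1, by
      rw [LinearIsometryEquiv.norm_map, (groverState s P j).2]⟩

/-- Prepare `s` (one step), perform `j` Grover iterations for the predicate `P`, and measure (one
step).  In each iteration `P` is evaluated in superposition, its value is used for a phase flip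
(one step), the evaluation is undone, and the reflection about `s` is applied (one step); an
evaluation in superposition takes as long as the slowest of the evaluations that occur in it. -/
def amplify (s : QState ι) (P : ι → Timed Bool) (j : ℕ) : QProg ι :=
  ⟨(measureState (groverState s (fun x => (P x).val) j)).map fun x =>
    (x, 2 + j * (2 * (Finset.univ.sup fun x => (P x).time) + 2))⟩

/-- The state `(∑ x, |x⟩) / √N`. -/
def uniformState (N : ℕ) [NeZero N] : QState (Fin N) :=
  ⟨WithLp.toLp 2 fun _ => (((√(N : ℝ))⁻¹ : ℝ) : ℂ), by
    have hN : (N : ℝ) ≠ 0 := Nat.cast_ne_zero.mpr (NeZero.ne N)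
    have h : ‖(WithLp.toLp 2 fun _ => (((√(N : ℝ))⁻¹ : ℝ) : ℂ) :
        EuclideanSpace ℂ (Fin N))‖ ^ 2 = 1 := by
      rw [EuclideanSpace.norm_sq_eq]
      simp [hN]
    exact (pow_eq_one_iff_of_nonneg (norm_nonneg _) two_ne_zero).mp h⟩

/-- The state `(∑ x, |x⟩) / √N ⊗ (cos β |0⟩ + sin β |1⟩)`. -/
def tiltedState (N : ℕ) [NeZero N] (β : ℝ) : QState (Fin N × Bool) :=
  ⟨WithLp.toLp 2 fun x =>
      (((√(N : ℝ))⁻¹ * (if x.2 = true then Real.sin β else Real.cos β) : ℝ) : ℂ), by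
    have hN : (N : ℝ) ≠ 0 := Nat.cast_ne_zero.mpr (NeZero.ne N)
    have h : ‖(WithLp.toLp 2 fun x =>
        (((√(N : ℝ))⁻¹ * (if x.2 = true then Real.sin β else Real.cos β) : ℝ) : ℂ) :
        EuclideanSpace ℂ (Fin N × Bool))‖ ^ 2 = 1 := by
      rw [EuclideanSpace.norm_sq_eq]
      simp only [Complex.norm_real, Real.norm_eq_abs, sq_abs, mul_pow, Fintype.sum_prod_type,
        Fintype.sum_bool, if_true, Bool.false_eq_true, if_false]
      rw [← mul_add, Real.sin_sq_add_cos_sq]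
      simp [hN]
    exact (pow_eq_one_iff_of_nonneg (norm_nonneg _) two_ne_zero).mp h⟩

end Quantum

/-! ## Search -/

section Search

variable {N : ℕ} [NeZero N]

/-- Verify a candidate. -/
def verify (P : Fin N → Timed Bool) (x : Fin N) : QProg (Option (Fin N)) := do
  if ← QProg.run (P x) then pure (some x) else pure none

/-- Choose an integer `0 ≤ j < m` uniformly at random (`m > 0`), run Grover's algorithm with `j`
iterations, and verify the outcome.  For an integer `j`, `j < m` is equivalent to `j < ⌈m⌉`. -/
def randomGrover (P : Fin N → Timed Bool) (m : ℝ) : QProg (Option (Fin N)) := do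
  let j ← QProg.uniform (Fin (⌈m⌉₊ - 1 + 1))
  let x ← amplify (uniformState N) P j
  verify P x

/-- *BBHT*: `randomGrover` with `m = 1, λ, λ², …` for `λ = 8/7`, as long as `m ≤ 2√N`. -/
def bbht (P : Fin N → Timed Bool) : QProg (Option (Fin N)) :=
  QProg.firstSome ((List.range (⌊Real.logb (8 / 7) (2 * √(N : ℝ))⌋₊ + 1)).map fun k =>
    randomGrover P ((8 / 7 : ℝ) ^ k))

/-- The number of iterations of the exact search for `t` solutions: the least `k` for which
`π / (4k + 2) ≤ θ`, where `sin² θ = t / N`. -/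
def exactIterations (N t : ℕ) : ℕ :=
  ⌈Real.pi / (4 * Real.arcsin √((t : ℝ) / N)) - 1 / 2⌉₊

/-- The angle `β` of the additional qubit, for which `sin β * sin θ = sin (π / (4k + 2))`. -/
def exactAngle (N t : ℕ) : ℝ :=
  Real.arcsin (Real.sin (Real.pi / (4 * (exactIterations N t : ℝ) + 2)) / √((t : ℝ) / N))

/-- Exact Grover search, which finds a solution with certainty if there are exactly `t` of them:
an additional qubit lowers the initial success amplitude to `sin (π / (4k + 2))`, so that `k`
iterations turn it into `1`.  One step is charged for the computation of `k` and `β`. -/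
def exactGrover (P : Fin N → Timed Bool) (t : ℕ) : QProg (Option (Fin N)) := do
  QProg.run (Timed.ticks 1)
  let r ← amplify (tiltedState N (exactAngle N t))
    (fun z => do let b ← P z.1; Timed.op (b && z.2)) (exactIterations N t)
  verify P r.1

/-- *BCWZ*, with parameter `ε⁻¹` and `t₀ = min N ⌈lg ε⁻¹⌉`: exact searches for `1, …, t₀`
solutions, followed by `3 t₀` searches for the case of more than `t₀` solutions, each with
fewer than `√(N / t₀) + 1` iterations. -/
def bcwz (P : Fin N → Timed Bool) (εinv : ℝ) : QProg (Option (Fin N)) :=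
  let t₀ : ℕ := min N ⌈Real.logb 2 εinv⌉₊
  QProg.firstSome
    ((List.range t₀).map (fun t => exactGrover P (t + 1)) ++
      List.replicate (3 * t₀) (randomGrover P √((N : ℝ) / t₀)))

/-- *findsol*: at most two runs of *BBHT*, then *BCWZ* with parameter `ε⁻¹`. -/
def findsol (P : Fin N → Timed Bool) (εinv : ℝ) : QProg (Option (Fin N)) :=
  QProg.firstSome [bbht P, bbht P, bcwz P εinv]

/-- The loop of *minfind*: look for an element with a smaller value than `y` until *findsol*
finds none.  The first argument bounds the number of rounds. -/
def minfindLoop (F : Fin N → Timed (WithTop ℝ)) (εinv : ℝ) : ℕ → Fin N → QProg (Fin N)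
  | 0, y => pure y
  | r + 1, y => do
    let v ← QProg.run (F y)
    match ← findsol (fun x => do let u ← F x; Timed.op (decide (u < v))) εinv with
    | some y' => minfindLoop F εinv r y'
    | none => pure y

/-- *minfind*.  Since the value strictly decreases from round to round, the loop always stops by
itself within `N` rounds. -/
def minfind (F : Fin N → Timed (WithTop ℝ)) (εinv : ℝ) : QProg (Fin N) := do
  let y ← QProg.uniform (Fin N)
  minfindLoop F εinv N y

end Search

/-! ## Weighted graphs -/

/-- A directed graph with vertices `Fin n`, real edge lengths and no self-edges:
`weight i j = some ℓ` if there is an edge from `i` to `j`, of length `ℓ`, and `weight i j = none`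
if there is no such edge.  `weight` is the black box of the adjacency matrix model.  (An
undirected graph has two opposite edges of equal length in place of each edge.) -/
structure WGraph (n : ℕ) where
  weight : Fin n → Fin n → Option ℝ
  no_self_edge : ∀ i, weight i i = none

namespace WGraph

variable {n : ℕ}

/-- The number of edges. -/
def numEdges (G : WGraph n) : ℕ :=
  (Finset.univ.filter fun p : Fin n × Fin n => (G.weight p.1 p.2).isSome = true).card

/-- `G.HasPath u v ℓ`: some directed path from `u` to `v` has total length `ℓ`.  (Vertices may
be repeated, and the path without edges is allowed.) -/
inductive HasPath (G : WGraph n) (u : Fin n) : Fin n → ℝ → Prop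
  | nil : HasPath G u u 0
  | snoc {v w : Fin n} {ℓ x : ℝ} :
      HasPath G u v ℓ → G.weight v w = some x → HasPath G u w (ℓ + x)

/-- A cycle of negative total length can be reached from `a`. -/
def NegCycleReachable (G : WGraph n) (a : Fin n) : Prop :=
  ∃ v : Fin n, (∃ ℓ, G.HasPath a v ℓ) ∧ ∃ c < 0, G.HasPath v v c

/-- `d` is the minimal length of a path from `a` to `v`, and `∞` if there is no path. -/
def IsShortestDist (G : WGraph n) (a v : Fin n) : WithTop ℝ → Prop
  | ⊤ => ∀ ℓ, ¬ G.HasPath a v ℓ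
  | (d : ℝ) => IsLeast {ℓ | G.HasPath a v ℓ} d

/-- The correct outputs of single-source shortest paths; `none` stands for the special value
*false*. -/
def Correct (G : WGraph n) (a : Fin n) : Option (Fin n → WithTop ℝ) → Prop
  | none => G.NegCycleReachable a
  | some d => ¬ G.NegCycleReachable a ∧ ∀ v, G.IsShortestDist a v (d v)

/-- An edge list (adjacency array) of `G`: the out-degree of each vertex, and for each vertex `i`
and `k < deg i` the destination and the length of the `k`-th edge outgoing from `i`, in an
arbitrary order. -/
structure EdgeList (G : WGraph n) where
  deg : Fin n → ℕ
  edge : (i : Fin n) → Fin (deg i) → Fin n × ℝ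
  dest_injective : ∀ i, Function.Injective fun k => (edge i k).1
  weight_eq_some_iff : ∀ i j ℓ, G.weight i j = some ℓ ↔ ∃ k, edge i k = (j, ℓ)

end WGraph

/-! ## The algorithm *SPNW* -/

section Algorithm

variable {n : ℕ}

/-- The classical memory: the arrays `dist` and `prev` (the previous vertex on the shortest path
found so far, if any), and a flag that records whether `dist` has been changed. -/
structure SPState (n : ℕ) where
  dist : Fin n → WithTop ℝ
  prev : Fin n → Option (Fin n)
  changed : Bool

/-- The initial memory; both arrays are filled in. -/
def initState (a : Fin n) : Timed (SPState n) := do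
  Timed.ticks (2 * n + 1)
  pure ⟨Function.update (fun _ => ⊤) a 0, fun _ => none, false⟩

/-- Relaxation of vertex `i`: *minfind* over a domain of candidate edges into `i`, where `cand`
computes the source and the length (`∞` if there is no such edge) of a candidate. -/
def relax {N : ℕ} [NeZero N] (cand : Fin N → Timed (Fin n × WithTop ℝ)) (εinv : ℝ)
    (i : Fin n) (S : SPState n) : QProg (SPState n) := do
  let F : Fin N → Timed (WithTop ℝ) := fun x => do
    let e ← cand x
    let d ← Timed.op (S.dist e.1)
    Timed.op (d + e.2)
  let x ← minfind F εinv
  let e ← QProg.run (cand x)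
  let c ← QProg.run (F x)
  let d ← QProg.run (Timed.op (S.dist i))
  if ← QProg.run (Timed.op (decide (c < d))) then do
    QProg.run (Timed.ticks 3)
    pure ⟨Function.update S.dist i c, Function.update S.prev i (some e.1), true⟩
  else pure S

/-- One pass over the vertices of the list `L`. -/
def pass (relaxAt : Fin n → SPState n → QProg (SPState n)) (L : List (Fin n))
    (S : SPState n) : QProg (SPState n) :=
  L.foldlM (fun S i => do QProg.run (Timed.ticks 1); relaxAt i S) S

/-- `n - 1` passes, and one more pass to see whether `dist` still changes. -/
def bellmanFord (relaxAt : Fin n → SPState n → QProg (SPState n)) (L : List (Fin n))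
    (a : Fin n) : QProg (Option (Fin n → WithTop ℝ)) := do
  let S₀ ← QProg.run (initState a)
  let S ← (List.range (n - 1)).foldlM
    (fun S _ => do QProg.run (Timed.ticks 1); pass relaxAt L S) S₀
  QProg.run (Timed.ticks 1)
  let S' ← pass relaxAt L { S with changed := false }
  if ← QProg.run (Timed.op S'.changed) then pure none else pure (some S'.dist)

/-- *SPNW* in the adjacency matrix model, for the black box `query`, the source `a` and the
probability of failure `ε`. -/
def spnwMatrix [NeZero n] (query : Fin n → Fin n → Option ℝ) (a : Fin n) (ε : ℝ) :
    QProg (Option (Fin n → WithTop ℝ)) :=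
  bellmanFord
    (fun i S => relax (N := n)
      (fun j => do
        let w ← Timed.op (query j i)
        match w with
        | some ℓ => Timed.op (j, (ℓ : WithTop ℝ))
        | none => Timed.op (j, ⊤))
      ((n : ℝ) ^ 2 / ε) i S)
    (List.finRange n) a

/-- The array `f`, whose entry `f i` lists the sources and lengths of the edges into `i`.  Each
edge costs one call of the black box and one (amortized) step to append an array entry. -/
def incoming (deg : Fin n → ℕ) (edge : (i : Fin n) → Fin (deg i) → Fin n × ℝ) :
    Timed (Fin n → List (Fin n × ℝ)) := do
  Timed.ticks n
  (List.finRange n).foldlM (fun f i => do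
    Timed.ticks 1
    (List.finRange (deg i)).foldlM (fun f k => do
      let e ← Timed.op (edge i k)
      Timed.op (Function.update f e.1 (f e.1 ++ [(i, e.2)]))) f) (fun _ => [])

/-- *SPNW* in the edge list model, for the black box `edge` and the known out-degrees `deg`.
There is nothing to relax at a vertex without incoming edges, so the passes run over the list of
the other vertices, which is set up in `n` steps. -/
def spnwEdgeList (deg : Fin n → ℕ) (edge : (i : Fin n) → Fin (deg i) → Fin n × ℝ)
    (a : Fin n) (ε : ℝ) : QProg (Option (Fin n → WithTop ℝ)) := do
  let f ← QProg.run (incoming deg edge)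
  QProg.run (Timed.ticks n)
  bellmanFord
    (fun i S =>
      if h : (f i).length = 0 then pure S
      else
        haveI : NeZero (f i).length := ⟨h⟩
        relax (N := (f i).length)
          (fun x => Timed.op (((f i).get x).1, (((f i).get x).2 : WithTop ℝ)))
          ((n : ℝ) ^ 2 / ε) i S)
    ((List.finRange n).filter fun i => decide ((f i).length ≠ 0)) a

end Algorithm

end QSP

end

/-! The algorithm is Bellman–Ford with a quantum minimum search inside each relaxation. Only one
fact about amplitudes is needed, `groverState_apply`: Grover iterations multiply all solution
amplitudes by one factor and all other amplitudes by another, and turn the state by `2θ` each time.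
So `j` iterations fail with probability `cos² ((2j+1)θ)`, and all solutions are equally likely
(`FindsUniformly`). The rest is classical probability.

Search for `t` solutions among `N`: averaging over random `j < m` with `m ≥ √(N/t)` gives failure at
most `3/4`. In `bbht` the cost of a round grows by `8/7` while, past the critical round, the chance
of reaching it shrinks by `3/4`; hence the expected time is `O(√(N/t))`, and going on up to `2√N`
makes the failure probability at most `1/(3t)`. `bcwz` lowers it to `ε'` in time `O(√(N t₀))`, where
`t₀ = min N ⌈lg (1/ε')⌉`.

Minimum finding: let `t` be the rank of the current element. Two runs of `bbht` bring the failure of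
`findsol` down to `ε'/(9t²)`. This is summable over the ranks, so the whole loop fails with
probability at most `ε'`, however many rounds it takes (`prob_minfindLoop_le`). A round costs `O(√(N
t₀)/√(max t 1))`, and each better element comes next with probability at most `1/t`; a bounded
potential solves this recurrence (`minfindPotential_step`), so `minfind` takes expected time `O(√(N
t₀))`.

Graphs: there are at most `n²` relaxations, each failing with probability at most `ε/n²`. If none
fails, the run is a classical Bellman–Ford run, which is correct (`correct_of_passes`). For `ε⁻¹`
polynomial in `n`, `t₀ = O(lg n)`. A pass then costs `O(n √(n lg n))` over the matrix, and over edge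
lists `O(∑ √(dᵢ lg n))` with in-degrees `dᵢ`, which is `O(√(n E lg n))` by Cauchy–Schwarz; there are
`n` passes. -/

namespace QSP

/-! ### Calculus of outcomes, failure probabilities and expected times -/

namespace QProg

/-- The law of the outcome, without the running time. -/
noncomputable def outcome {α : Type} (p : QProg α) : PMF α := p.law.map Prod.fst

variable {α β : Type}

theorem prob_eq_outcome (p : QProg α) (A : Set α) :
    p.prob A = p.outcome.toOuterMeasure A := by
  rw [outcome, PMF.toOuterMeasure_map_apply]; rfl

theorem outcome_pure (a : α) : (pure a : QProg α).outcome = PMF.pure a := by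
  show (PMF.pure (a, 0)).map Prod.fst = _
  rw [PMF.pure_map]

theorem outcome_run (t : Timed α) : (run t).outcome = PMF.pure t.val := by
  show (PMF.pure (t.val, t.time)).map Prod.fst = _
  rw [PMF.pure_map]

theorem outcome_uniform (ι : Type) [Fintype ι] [Nonempty ι] :
    (uniform ι).outcome = PMF.uniformOfFintype ι := by
  show (((PMF.uniformOfFintype ι).map fun x => (x, 1))).map Prod.fst = _
  rw [PMF.map_comp]
  exact PMF.map_id _

theorem outcome_bind (p : QProg α) (f : α → QProg β) :
    (p >>= f).outcome = p.outcome.bind fun a => (f a).outcome := by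
  show (p.law.bind fun r => (f r.1).law.map fun s => (s.1, r.2 + s.2)).map Prod.fst = _
  rw [PMF.map_bind, outcome, PMF.bind_map]
  congr 1
  funext r
  rw [PMF.map_comp]
  rfl

theorem tsum_map_mul {γ δ : Type} (p : PMF γ) (g : γ → δ) (h : δ → ℝ≥0∞) :
    ∑' b, p.map g b * h b = ∑' a, p a * h (g a) := by
  classical
  simp only [PMF.map_apply, ← ENNReal.tsum_mul_right]
  rw [ENNReal.tsum_comm]
  refine tsum_congr fun a => ?_
  rw [tsum_eq_single (g a)]
  · simp
  · intro b hb; simp [hb]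

theorem tsum_bind_mul {γ δ : Type} (p : PMF γ) (g : γ → PMF δ) (h : δ → ℝ≥0∞) :
    ∑' b, p.bind g b * h b = ∑' a, p a * ∑' b, g a b * h b := by
  simp only [PMF.bind_apply, ← ENNReal.tsum_mul_right, ← ENNReal.tsum_mul_left]
  rw [ENNReal.tsum_comm]
  simp only [mul_assoc]

theorem expectedTime_pure (a : α) : (pure a : QProg α).expectedTime = 0 := by
  show ∑' r : α × ℕ, PMF.pure (a, 0) r * (r.2 : ℝ≥0∞) = 0
  rw [tsum_eq_single (a, 0)]
  · simp
  · intro b hb; simp [PMF.pure_apply, hb]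

theorem expectedTime_run (t : Timed α) : (run t).expectedTime = t.time := by
  show ∑' r : α × ℕ, PMF.pure (t.val, t.time) r * (r.2 : ℝ≥0∞) = _
  rw [tsum_eq_single (t.val, t.time)]
  · simp
  · intro b hb; simp [PMF.pure_apply, hb]

theorem expectedTime_uniform (ι : Type) [Fintype ι] [Nonempty ι] :
    (uniform ι).expectedTime = 1 := by
  show ∑' r : ι × ℕ, ((PMF.uniformOfFintype ι).map fun x => (x, 1)) r * (r.2 : ℝ≥0∞) = _
  rw [tsum_map_mul]
  simpa using (PMF.uniformOfFintype ι).tsum_coe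

/-- Times add, and the second algorithm sees only the outcome of the first, so the time of the first
can be integrated out. -/
theorem expectedTime_bind (p : QProg α) (f : α → QProg β) :
    (p >>= f).expectedTime = p.expectedTime + ∑' a, p.outcome a * (f a).expectedTime := by
  show ∑' r : β × ℕ, (p.law.bind fun r => (f r.1).law.map fun s => (s.1, r.2 + s.2)) r *
    (r.2 : ℝ≥0∞) = _
  rw [tsum_bind_mul, outcome, tsum_map_mul, expectedTime, ← ENNReal.tsum_add]
  refine tsum_congr fun r => ?_
  rw [tsum_map_mul, ← mul_add]
  congr 1
  simp only [Nat.cast_add, mul_add, ENNReal.tsum_add]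
  rw [ENNReal.tsum_mul_right, PMF.tsum_coe, one_mul]
  rfl

theorem outcome_run_bind (t : Timed α) (f : α → QProg β) :
    (run t >>= f).outcome = (f t.val).outcome := by
  rw [outcome_bind, outcome_run, PMF.pure_bind]

theorem expectedTime_run_bind (t : Timed α) (f : α → QProg β) :
    (run t >>= f).expectedTime = t.time + (f t.val).expectedTime := by
  rw [expectedTime_bind, expectedTime_run, outcome_run, tsum_eq_single t.val]
  · simp
  · intro b hb; simp [PMF.pure_apply, hb]

theorem tsum_outcome_mul_le (p : PMF α) {f : α → ℝ≥0∞} {c : ℝ≥0∞} (h : ∀ a, f a ≤ c) :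
    ∑' a, p a * f a ≤ c := by
  calc ∑' a, p a * f a ≤ ∑' a, p a * c := ENNReal.tsum_le_tsum fun a => by gcongr; exact h a
    _ = c := by rw [ENNReal.tsum_mul_right, PMF.tsum_coe, one_mul]

theorem expectedTime_bind_le {p : QProg α} {f : α → QProg β} {c d : ℝ≥0∞}
    (hp : p.expectedTime ≤ c) (hf : ∀ a, (f a).expectedTime ≤ d) :
    (p >>= f).expectedTime ≤ c + d := by
  rw [expectedTime_bind]
  exact add_le_add hp (tsum_outcome_mul_le _ hf)

theorem prob_pure_le {A : Set α} {a : α} (h : a ∉ A) : (pure a : QProg α).prob A = 0 := by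
  rw [prob_eq_outcome, outcome_pure, PMF.toOuterMeasure_pure_apply, if_neg h]

theorem prob_run_bind (t : Timed α) (f : α → QProg β) (A : Set β) :
    (run t >>= f).prob A = (f t.val).prob A := by
  rw [prob_eq_outcome, outcome_run_bind, prob_eq_outcome]

theorem prob_bind (p : QProg α) (f : α → QProg β) (A : Set β) :
    (p >>= f).prob A = ∑' a, p.outcome a * (f a).prob A := by
  simp only [prob_eq_outcome, outcome_bind, PMF.toOuterMeasure_bind_apply]

theorem prob_le_one (p : QProg α) (A : Set α) : p.prob A ≤ 1 := by
  rw [prob_eq_outcome, PMF.toOuterMeasure_apply, ← p.outcome.tsum_coe]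
  exact ENNReal.tsum_le_tsum fun a => Set.indicator_le_self' (fun _ _ => zero_le) a

theorem prob_mono (p : QProg α) {A B : Set α} (h : A ⊆ B) : p.prob A ≤ p.prob B := by
  rw [prob_eq_outcome, prob_eq_outcome]
  exact p.outcome.toOuterMeasure.mono h

theorem one_sub_le_prob {p : QProg α} {A : Set α} {δ : ℝ≥0∞} (h : p.prob Aᶜ ≤ δ) :
    1 - δ ≤ p.prob A := by
  have : 1 ≤ p.prob A + p.prob Aᶜ := by
    rw [prob_eq_outcome, prob_eq_outcome,
      ← (PMF.toOuterMeasure_apply_eq_one_iff p.outcome Set.univ).2 (Set.subset_univ _),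
      ← Set.union_compl_self A]
    exact MeasureTheory.measure_union_le _ _
  exact tsub_le_iff_right.2 (this.trans (by gcongr))

/-- The union bound for two consecutive algorithms. -/
theorem prob_compl_bind_le {p : QProg α} {f : α → QProg β} {A : Set α} {B : Set β}
    {δ η : ℝ≥0∞} (hp : p.prob Aᶜ ≤ δ) (hf : ∀ a ∈ A, (f a).prob Bᶜ ≤ η) :
    (p >>= f).prob Bᶜ ≤ δ + η := by
  classical
  rw [prob_bind]
  calc ∑' a, p.outcome a * (f a).prob Bᶜ
      ≤ ∑' a, ((Aᶜ).indicator p.outcome a + p.outcome a * η) := by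
        refine ENNReal.tsum_le_tsum fun a => ?_
        by_cases ha : a ∈ A
        · rw [Set.indicator_of_notMem (by simpa using ha), zero_add]
          gcongr; exact hf a ha
        · rw [Set.indicator_of_mem (by simpa using ha)]
          refine le_add_right ?_
          exact mul_le_of_le_one_right (zero_le) (prob_le_one _ _)
    _ = p.prob Aᶜ + η := by
        rw [ENNReal.tsum_add, ENNReal.tsum_mul_right, PMF.tsum_coe, one_mul, prob_eq_outcome,
          PMF.toOuterMeasure_apply]
    _ ≤ δ + η := by gcongr

theorem tsum_option (f : Option α → ℝ≥0∞) : ∑' o, f o = f none + ∑' a, f (some a) := by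
  rw [← (Equiv.optionEquivSumPUnit.{0} α).symm.tsum_eq, Summable.tsum_sum ENNReal.summable ENNReal.summable]
  simp [add_comm]

theorem outcome_firstSome_cons_some (p : QProg (Option α)) (ps : List (QProg (Option α)))
    (x : α) : (firstSome (p :: ps)).outcome (some x) =
      p.outcome (some x) + p.outcome none * (firstSome ps).outcome (some x) := by
  classical
  rw [firstSome, outcome_bind, PMF.bind_apply, tsum_option, add_comm, tsum_eq_single x]
  · simp [outcome_pure]
  · intro y hy; simp [outcome_pure, PMF.pure_apply, hy.symm]

theorem outcome_firstSome_cons_none (p : QProg (Option α)) (ps : List (QProg (Option α))) :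
    (firstSome (p :: ps)).outcome none = p.outcome none * (firstSome ps).outcome none := by
  rw [firstSome, outcome_bind, PMF.bind_apply, tsum_option]
  simp [outcome_pure, PMF.pure_apply]

theorem expectedTime_firstSome_nil : (firstSome ([] : List (QProg (Option α)))).expectedTime = 0 := by
  rw [firstSome, expectedTime_pure]

theorem expectedTime_firstSome_cons (p : QProg (Option α)) (ps : List (QProg (Option α))) :
    (firstSome (p :: ps)).expectedTime =
      p.expectedTime + p.outcome none * (firstSome ps).expectedTime := by
  rw [firstSome, expectedTime_bind, tsum_option]
  simp [expectedTime_pure]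

theorem outcome_firstSome_none (ps : List (QProg (Option α))) :
    (firstSome ps).outcome none = (ps.map fun p => p.outcome none).prod := by
  induction ps with
  | nil => simp [firstSome, outcome_pure]
  | cons p ps ih => rw [outcome_firstSome_cons_none, ih, List.map_cons, List.prod_cons]

theorem expectedTime_firstSome_le_sum (ps : List (QProg (Option α))) :
    (firstSome ps).expectedTime ≤ (ps.map fun p => p.expectedTime).sum := by
  induction ps with
  | nil => simp [expectedTime_firstSome_nil]
  | cons p ps ih =>
    rw [expectedTime_firstSome_cons, List.map_cons, List.sum_cons]
    gcongr
    exact (mul_le_of_le_one_left (zero_le) (p.outcome.coe_le_one _)).trans ih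

theorem expectedTime_foldlM_le {σ : Type} (f : σ → α → QProg σ) (b : α → ℝ≥0∞) (L : List α)
    (hf : ∀ s, ∀ a ∈ L, (f s a).expectedTime ≤ b a) (s : σ) :
    (L.foldlM f s).expectedTime ≤ (L.map b).sum := by
  induction L generalizing s with
  | nil => simp [List.foldlM, expectedTime_pure]
  | cons a L ih =>
    rw [List.foldlM_cons, List.map_cons, List.sum_cons]
    exact expectedTime_bind_le (hf s a (by simp))
      fun s' => ih (fun s a ha => hf s a (List.mem_cons_of_mem _ ha)) s'

/-- `FoldRel R L s s'`: the elements of `L`, in turn, lead from `s` to `s'` by steps in `R`. -/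
inductive FoldRel {σ : Type} (R : α → σ → σ → Prop) : List α → σ → σ → Prop
  | nil (s : σ) : FoldRel R [] s s
  | cons {a : α} {L : List α} {s s' s'' : σ} :
      R a s s' → FoldRel R L s' s'' → FoldRel R (a :: L) s s''

/-- A union bound over the steps. No independence is needed, because the failure bound is assumed
for every state that a step may start from. -/
theorem prob_foldlM_compl_le {σ : Type} (f : σ → α → QProg σ) (R : α → σ → σ → Prop)
    (δ : ℝ≥0∞) (L : List α) (hf : ∀ s, ∀ a ∈ L, (f s a).prob {s' | R a s s'}ᶜ ≤ δ) (s : σ) :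
    (L.foldlM f s).prob {s' | FoldRel R L s s'}ᶜ ≤ L.length * δ := by
  induction L generalizing s with
  | nil =>
    rw [List.foldlM_nil, prob_pure_le]
    · simp
    · simpa using FoldRel.nil s
  | cons a L ih =>
    rw [List.foldlM_cons, List.length_cons, Nat.cast_add, Nat.cast_one, add_mul, one_mul, add_comm]
    refine prob_compl_bind_le (hf s a (by simp)) fun s' hs' => ?_
    refine le_trans (prob_mono _ ?_) (ih (fun s a ha => hf s a (List.mem_cons_of_mem _ ha)) s')
    exact Set.compl_subset_compl.2 fun s'' h => FoldRel.cons hs' h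

end QProg
end QSP
namespace QSP

/-! ### Amplitudes under Grover iterations -/

section Grover

variable {ι : Type} [Fintype ι]

theorem phaseOracle_apply (P : ι → Bool) (ψ : EuclideanSpace ℂ ι) (x : ι) :
    phaseOracle P ψ x = if P x = true then -ψ x else ψ x := by
  unfold phaseOracle
  rw [LinearIsometryEquiv.piLpCongrRight_apply]
  split_ifs with h <;> simp [h]

theorem groverStep_apply (s : QState ι) (P : ι → Bool) (ψ : EuclideanSpace ℂ ι) :
    groverStep s P ψ = (2 : ℂ) • (inner ℂ s.1 (phaseOracle P ψ) • s.1) - phaseOracle P ψ := by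
  unfold groverStep
  rw [LinearIsometryEquiv.trans_apply, Submodule.reflection_apply,
    Submodule.starProjection_unit_singleton ℂ s.2, two_smul, two_smul]

theorem QState.sum_norm_sq (s : QState ι) : ∑ x, ‖s.1 x‖ ^ 2 = 1 := by
  rw [← EuclideanSpace.norm_sq_eq, s.2, one_pow]

/-- The amplitudes after `j` Grover iterations: the solutions and the other basis states keep
their relative amplitudes, and the angle between the state and the span of the latter grows from
`θ` to `(2 j + 1) θ`. -/
theorem groverState_apply (s : QState ι) (P : ι → Bool) (θ : ℝ)
    (hθ : ∑ x with P x = true, ‖s.1 x‖ ^ 2 = Real.sin θ ^ 2) (j : ℕ) :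
    ∃ A B : ℝ, A * Real.sin θ = Real.sin ((2 * j + 1) * θ) ∧
      B * Real.cos θ = Real.cos ((2 * j + 1) * θ) ∧
      ∀ x, (groverState s P j).1 x = ((if P x = true then A else B : ℝ) : ℂ) * s.1 x := by
  have hθ' : ∑ x with ¬ P x = true, ‖s.1 x‖ ^ 2 = Real.cos θ ^ 2 := by
    have h1 := Finset.sum_filter_add_sum_filter_not Finset.univ (fun x => P x = true)
      fun x => ‖s.1 x‖ ^ 2
    rw [s.sum_norm_sq, hθ] at h1
    linarith [Real.sin_sq_add_cos_sq θ]
  induction j with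
  -- The factors are tied to `θ` by products instead of quotients, so `sin θ = 0` and `cos θ = 0`
  -- need no separate treatment.
  | zero => exact ⟨1, 1, by simp, by simp, fun x => by simp [groverState]⟩
  | succ j ih =>
    obtain ⟨A, B, hA, hB, h⟩ := ih
    have hin : inner ℂ s.1 (phaseOracle P (groverState s P j).1) =
        ((-A * Real.sin θ ^ 2 + B * Real.cos θ ^ 2 : ℝ) : ℂ) := by
      rw [← hθ, ← hθ', PiLp.inner_apply, Finset.mul_sum, Finset.mul_sum, Finset.sum_filter,
        Finset.sum_filter, ← Finset.sum_add_distrib, Complex.ofReal_sum]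
      refine Finset.sum_congr rfl fun x _ => ?_
      have hx : s.1 x * (starRingEnd ℂ) (s.1 x) = ((‖s.1 x‖ ^ 2 : ℝ) : ℂ) := by
        rw [Complex.mul_conj, Complex.normSq_eq_norm_sq]
      rw [phaseOracle_apply, h x, RCLike.inner_apply]
      split_ifs with hP
      · push_cast at hx ⊢
        linear_combination (-A : ℂ) * hx
      · push_cast at hx ⊢
        linear_combination (B : ℂ) * hx
    have hs : Real.sin ((2 * (j + 1 : ℕ) + 1) * θ) =
        Real.sin ((2 * j + 1) * θ) * Real.cos (2 * θ) +
          Real.cos ((2 * j + 1) * θ) * Real.sin (2 * θ) := by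
      rw [← Real.sin_add]; push_cast; ring_nf
    have hc : Real.cos ((2 * (j + 1 : ℕ) + 1) * θ) =
        Real.cos ((2 * j + 1) * θ) * Real.cos (2 * θ) -
          Real.sin ((2 * j + 1) * θ) * Real.sin (2 * θ) := by
      rw [← Real.cos_add]; push_cast; ring_nf
    -- With `c` the inner product computed in `hin`, the reflection sends a coefficient `z` to `2c -
    -- z`. The oracle has turned `A` into `-A` and left `B` alone.
    refine ⟨2 * (-A * Real.sin θ ^ 2 + B * Real.cos θ ^ 2) + A,
      2 * (-A * Real.sin θ ^ 2 + B * Real.cos θ ^ 2) - B, ?_, ?_, fun x => ?_⟩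
    · rw [hs, ← hA, ← hB, Real.cos_two_mul, Real.sin_two_mul]
      linear_combination (-2 * A * Real.sin θ) * Real.sin_sq_add_cos_sq θ
    · rw [hc, ← hA, ← hB, Real.cos_two_mul, Real.sin_two_mul]
      ring
    · show groverStep s P (groverState s P j).1 x = _
      rw [groverStep_apply, hin, PiLp.sub_apply, PiLp.smul_apply, PiLp.smul_apply,
        phaseOracle_apply, h x]
      split_ifs with hP <;> push_cast <;> simp only [smul_eq_mul] <;> ring

theorem exists_sin_sq_eq (s : QState ι) (P : ι → Bool) :
    ∃ θ : ℝ, ∑ x with P x = true, ‖s.1 x‖ ^ 2 = Real.sin θ ^ 2 := by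
  set p := ∑ x with P x = true, ‖s.1 x‖ ^ 2
  have h0 : 0 ≤ p := Finset.sum_nonneg fun _ _ => by positivity
  have h1 : p ≤ 1 := by
    rw [← s.sum_norm_sq]
    exact Finset.sum_le_sum_of_subset_of_nonneg (Finset.filter_subset _ _)
      fun _ _ _ => by positivity
  refine ⟨Real.arcsin √p, ?_⟩
  rw [Real.sin_arcsin (by linarith [Real.sqrt_nonneg p]) (Real.sqrt_le_one.2 h1), Real.sq_sqrt h0]

theorem measureState_apply (ψ : QState ι) (x : ι) :
    measureState ψ x = ENNReal.ofReal (‖ψ.1 x‖ ^ 2) := rfl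

/-- After `j` Grover iterations, the outcome is no solution with probability
`cos² ((2 j + 1) θ)`. -/
theorem measureState_groverState_compl (s : QState ι) (P : ι → Bool) (θ : ℝ)
    (hθ : ∑ x with P x = true, ‖s.1 x‖ ^ 2 = Real.sin θ ^ 2) (j : ℕ) :
    ∑ x with ¬ P x = true, measureState (groverState s P j) x =
      ENNReal.ofReal (Real.cos ((2 * j + 1) * θ) ^ 2) := by
  obtain ⟨A, B, hA, hB, h⟩ := groverState_apply s P θ hθ j
  have hθ' : ∑ x with ¬ P x = true, ‖s.1 x‖ ^ 2 = Real.cos θ ^ 2 := by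
    have h1 := Finset.sum_filter_add_sum_filter_not Finset.univ (fun x => P x = true)
      fun x => ‖s.1 x‖ ^ 2
    rw [s.sum_norm_sq, hθ] at h1
    linarith [Real.sin_sq_add_cos_sq θ]
  simp only [measureState_apply]
  rw [← ENNReal.ofReal_sum_of_nonneg fun _ _ => by positivity, ← hB, mul_pow, ← hθ',
    Finset.mul_sum]
  congr 1
  refine Finset.sum_congr rfl fun x hx => ?_
  rw [h x, if_neg (Finset.mem_filter.1 hx).2, norm_mul, mul_pow, Complex.norm_real,
    Real.norm_eq_abs, sq_abs]

theorem outcome_amplify (s : QState ι) (P : ι → Timed Bool) (j : ℕ) :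
    (amplify s P j).outcome = measureState (groverState s (fun x => (P x).val) j) := by
  rw [QProg.outcome, amplify, PMF.map_comp]
  exact PMF.map_id _

theorem expectedTime_amplify_le (s : QState ι) (P : ι → Timed Bool) (j q : ℕ)
    (hq : ∀ x, (P x).time ≤ q) :
    (amplify s P j).expectedTime ≤ ((2 + j * (2 * q + 2) : ℕ) : ℝ≥0∞) := by
  rw [QProg.expectedTime, amplify, QProg.tsum_map_mul]
  refine QProg.tsum_outcome_mul_le _ fun x => ?_
  have : (Finset.univ.sup fun x => (P x).time) ≤ q := Finset.sup_le fun x _ => hq x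
  dsimp only
  gcongr

end Grover

/-! ### Average failure for a random number of iterations -/

section Trigonometry

/-- A telescoping sum: the closed form `M/2 + sin (4Mθ) / (4 sin 2θ)`, with its denominator cleared.
-/
theorem sum_cos_sq (θ : ℝ) (M : ℕ) :
    4 * Real.sin (2 * θ) * ∑ j ∈ Finset.range M, Real.cos ((2 * j + 1) * θ) ^ 2 =
      2 * M * Real.sin (2 * θ) + Real.sin (4 * M * θ) := by
  induction M with
  | zero => simp
  | succ M ih =>
    rw [Finset.sum_range_succ, mul_add, ih]
    have h1 : Real.sin (4 * ((M + 1 : ℕ) : ℝ) * θ) =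
        Real.sin ((4 * M + 2) * θ) * Real.cos (2 * θ) +
        Real.cos ((4 * M + 2) * θ) * Real.sin (2 * θ) := by
      rw [← Real.sin_add]; push_cast; ring_nf
    have h2 : Real.sin (4 * M * θ) =
        Real.sin ((4 * M + 2) * θ) * Real.cos (2 * θ) -
        Real.cos ((4 * M + 2) * θ) * Real.sin (2 * θ) := by
      rw [← Real.sin_sub]; ring_nf
    have h3 : Real.cos ((4 * M + 2) * θ) = 2 * Real.cos ((2 * M + 1) * θ) ^ 2 - 1 := by
      rw [← Real.cos_two_mul]; ring_nf
    rw [h1, h2, h3]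
    push_cast
    ring

/-- Random numbers `j < M` of Grover iterations fail with probability at most `3 / 4`, if
`1 / sin θ ≤ M`. -/
theorem sum_cos_sq_le {θ : ℝ} (h0 : 0 < θ) (h1 : θ ≤ Real.pi / 2) {M : ℕ}
    (hM : 1 ≤ M * Real.sin θ) :
    ∑ j ∈ Finset.range M, Real.cos ((2 * j + 1) * θ) ^ 2 ≤ 3 / 4 * M := by
  -- At `π/2` the factor `sin 2θ` of the closed form vanishes, but so does every cosine.
  rcases h1.eq_or_lt with rfl | h1
  · have : ∀ j ∈ Finset.range M, Real.cos ((2 * j + 1) * (Real.pi / 2)) ^ 2 = 0 := by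
      intro j _
      rw [sq_eq_zero_iff, Real.cos_eq_zero_iff]
      exact ⟨j, by push_cast; ring⟩
    rw [Finset.sum_eq_zero this]
    positivity
  have hs2 : 0 < Real.sin (2 * θ) := Real.sin_pos_of_pos_of_lt_pi (by linarith) (by linarith)
  -- By the closed form this is the claim. If `cos θ ≥ 1/2`, then `sin 2θ ≥ sin θ` and the right
  -- side is at least `1`. Otherwise let `φ = π/2 - θ`: the left side is `-sin (4Mφ)`, which is
  -- nonpositive for `4Mφ ≤ π`; beyond that, Jordan's inequality makes the right side at least
  -- `4Mφ/π > 1`.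
  have key : Real.sin (4 * M * θ) ≤ M * Real.sin (2 * θ) := by
    have hM0 : (0 : ℝ) ≤ M := Nat.cast_nonneg M
    have hs : 0 ≤ Real.sin θ := Real.sin_nonneg_of_nonneg_of_le_pi h0.le (by linarith)
    rcases le_or_gt (1 / 2) (Real.cos θ) with hc | hc
    · refine (Real.sin_le_one _).trans (hM.trans ?_)
      rw [Real.sin_two_mul]
      gcongr
      nlinarith
    · set φ := Real.pi / 2 - θ with hφ
      have e1 : Real.sin (4 * M * θ) = -Real.sin (4 * M * φ) := by
        have : 4 * M * θ = -(4 * M * φ) + (M : ℕ) * (2 * Real.pi) := by rw [hφ]; ring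
        rw [this, Real.sin_add_nat_mul_two_pi, Real.sin_neg]
      have e2 : Real.sin (2 * θ) = Real.sin (2 * φ) := by
        rw [hφ, ← Real.sin_pi_sub]; ring_nf
      have hθ3 : Real.pi / 3 < θ := by
        by_contra hcon
        have := Real.cos_le_cos_of_nonneg_of_le_pi h0.le (by linarith) (not_lt.1 hcon)
        rw [Real.cos_pi_div_three] at this
        linarith
      rw [e1, e2]
      rcases le_or_gt (4 * M * φ) Real.pi with h | h
      · have : 0 ≤ Real.sin (4 * M * φ) :=
          Real.sin_nonneg_of_nonneg_of_le_pi (by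
            have : 0 ≤ φ := by rw [hφ]; linarith
            positivity) h
        have : 0 ≤ M * Real.sin (2 * φ) := by rw [← e2]; positivity
        linarith
      · have hj := Real.mul_le_sin (x := 2 * φ) (by rw [hφ]; linarith) (by rw [hφ]; linarith)
        have : 1 ≤ M * (2 / Real.pi * (2 * φ)) := by
          have : M * (2 / Real.pi * (2 * φ)) = 4 * M * φ / Real.pi := by ring
          rw [this, le_div_iff₀ Real.pi_pos]
          linarith
        nlinarith [Real.neg_one_le_sin (4 * M * φ)]
  have := sum_cos_sq θ M
  nlinarith

end Trigonometry
end QSP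
namespace QSP

/-! ### Searches that treat all solutions alike -/

section Search

variable {N : ℕ}

/-- The solutions of a search problem. -/
def solutions (P : Fin N → Timed Bool) : Finset (Fin N) :=
  Finset.univ.filter fun x => (P x).val = true

theorem mem_solutions {P : Fin N → Timed Bool} {x : Fin N} :
    x ∈ solutions P ↔ (P x).val = true := by
  simp [solutions]

theorem card_solutions_le (P : Fin N → Timed Bool) : (solutions P).card ≤ N := by
  simpa using Finset.card_le_univ (solutions P)

/-- A search that returns solutions only, each of them with the same probability. -/
structure FindsUniformly (P : Fin N → Timed Bool) (p : QProg (Option (Fin N))) : Prop where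
  eq_zero : ∀ x, x ∉ solutions P → p.outcome (some x) = 0
  eq : ∀ x y, x ∈ solutions P → y ∈ solutions P → p.outcome (some x) = p.outcome (some y)

theorem FindsUniformly.bind {α : Type} {P : Fin N → Timed Bool} {p : QProg α}
    {f : α → QProg (Option (Fin N))} (hf : ∀ a, FindsUniformly P (f a)) :
    FindsUniformly P (p >>= f) where
  eq_zero x hx := by
    rw [QProg.outcome_bind, PMF.bind_apply]
    simp [(hf _).eq_zero x hx]
  eq x y hx hy := by
    simp only [QProg.outcome_bind, PMF.bind_apply, fun a => (hf a).eq x y hx hy]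

theorem FindsUniformly.firstSome {P : Fin N → Timed Bool} {ps : List (QProg (Option (Fin N)))}
    (h : ∀ p ∈ ps, FindsUniformly P p) : FindsUniformly P (QProg.firstSome ps) := by
  induction ps with
  | nil =>
    have h0 (x : Fin N) : (QProg.firstSome ([] : List (QProg (Option (Fin N))))).outcome
        (some x) = 0 := by
      rw [QProg.firstSome, QProg.outcome_pure, PMF.pure_apply]; simp
    exact ⟨fun x _ => h0 x, fun x y _ _ => by rw [h0, h0]⟩
  | cons p ps ih =>
    have h1 := h p (by simp)
    have h2 := ih fun p hp => h p (List.mem_cons_of_mem _ hp)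
    refine ⟨fun x hx => ?_, fun x y hx hy => ?_⟩
    · rw [QProg.outcome_firstSome_cons_some, h1.eq_zero x hx, h2.eq_zero x hx]; simp
    · rw [QProg.outcome_firstSome_cons_some, QProg.outcome_firstSome_cons_some, h1.eq x y hx hy,
        h2.eq x y hx hy]

/-- The solutions share a total probability of at most `1` equally. This is how uniformity enters
the running time of `minfind`. -/
theorem FindsUniformly.card_mul_outcome_le {P : Fin N → Timed Bool}
    {p : QProg (Option (Fin N))} (h : FindsUniformly P p) {x : Fin N} (hx : x ∈ solutions P) :
    (solutions P).card * p.outcome (some x) ≤ 1 := by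
  rw [← nsmul_eq_mul, ← Finset.sum_const, ← p.outcome.tsum_coe, QProg.tsum_option, tsum_fintype]
  refine le_add_left ?_
  rw [Finset.sum_congr rfl fun y hy => h.eq x y hx hy]
  exact Finset.sum_le_sum_of_subset (Finset.subset_univ _)

theorem outcome_verify (P : Fin N → Timed Bool) (x : Fin N) :
    (verify P x).outcome = PMF.pure (if (P x).val = true then some x else none) := by
  rw [verify, QProg.outcome_run_bind]
  split_ifs <;> rw [QProg.outcome_pure]

theorem expectedTime_verify_le {P : Fin N → Timed Bool} {q : ℕ} (hq : ∀ x, (P x).time ≤ q)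
    (x : Fin N) : (verify P x).expectedTime ≤ q := by
  rw [verify, QProg.expectedTime_run_bind]
  split_ifs <;> rw [QProg.expectedTime_pure, add_zero] <;> exact_mod_cast hq x

theorem outcome_bind_verify_none {κ : Type} [Fintype κ] (P : Fin N → Timed Bool) (p : QProg κ)
    (g : κ → Fin N) : (p >>= fun r => verify P (g r)).outcome none =
      ∑ r with ¬ (P (g r)).val = true, p.outcome r := by
  rw [QProg.outcome_bind, PMF.bind_apply, tsum_fintype, Finset.sum_filter]
  refine Finset.sum_congr rfl fun r _ => ?_
  rw [outcome_verify, PMF.pure_apply]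
  split_ifs <;> simp_all

theorem outcome_bind_verify_some {κ : Type} [Fintype κ] (P : Fin N → Timed Bool) (p : QProg κ)
    (g : κ → Fin N) (x : Fin N) : (p >>= fun r => verify P (g r)).outcome (some x) =
      if (P x).val = true then ∑ r with g r = x, p.outcome r else 0 := by
  rw [QProg.outcome_bind, PMF.bind_apply, tsum_fintype, Finset.sum_filter]
  simp only [outcome_verify, PMF.pure_apply]
  split_ifs with h
  · refine Finset.sum_congr rfl fun r _ => ?_
    by_cases hr : g r = x
    · subst hr; simp [h]
    · have : some x ≠ if (P (g r)).val = true then some (g r) else none := by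
        split_ifs <;> simp [Ne.symm hr]
      simp [this, hr]
  · refine Finset.sum_eq_zero fun r _ => ?_
    have : some x ≠ if (P (g r)).val = true then some (g r) else none := by
      split_ifs with h'
      · rintro ⟨⟩; exact h h'
      · simp
    simp [this]

/-! ### Random numbers of Grover iterations -/

variable [NeZero N]

theorem norm_sq_uniformState_apply (x : Fin N) : ‖(uniformState N).1 x‖ ^ 2 = (N : ℝ)⁻¹ := by
  simp [uniformState]

theorem sum_uniformState (P : Fin N → Timed Bool) :
    ∑ x with (P x).val = true, ‖(uniformState N).1 x‖ ^ 2 = (solutions P).card / N := by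
  simp only [norm_sq_uniformState_apply]
  rw [Finset.sum_const, nsmul_eq_mul, solutions, div_eq_mul_inv]

/-- All solutions start with the same amplitude and acquire the same factor `A`. -/
theorem findsUniformly_amplify_uniformState (P : Fin N → Timed Bool) (j : ℕ) :
    FindsUniformly P (amplify (uniformState N) P j >>= fun x => verify P x) := by
  obtain ⟨θ, hθ⟩ := exists_sin_sq_eq (uniformState N) fun x => (P x).val
  obtain ⟨A, B, -, -, h⟩ := groverState_apply _ _ θ hθ j
  have hx (x : Fin N) (hx : x ∈ solutions P) :
      (amplify (uniformState N) P j >>= fun x => verify P x).outcome (some x) =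
        ENNReal.ofReal (A ^ 2 * (N : ℝ)⁻¹) := by
    rw [mem_solutions] at hx
    rw [outcome_bind_verify_some P _ fun x => x, if_pos hx, Finset.sum_filter]
    simp only [Finset.sum_ite_eq', Finset.mem_univ, if_true]
    rw [outcome_amplify, measureState_apply, h x, if_pos hx, norm_mul, mul_pow,
      norm_sq_uniformState_apply, Complex.norm_real, Real.norm_eq_abs, sq_abs]
  refine ⟨fun x h => ?_, fun x y h1 h2 => by rw [hx x h1, hx y h2]⟩
  rw [mem_solutions] at h
  rw [outcome_bind_verify_some P _ fun x => x, if_neg h]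

theorem findsUniformly_randomGrover (P : Fin N → Timed Bool) (m : ℝ) :
    FindsUniformly P (randomGrover P m) :=
  FindsUniformly.bind fun j => findsUniformly_amplify_uniformState P j

theorem card_div_mem {t : ℕ} (ht : t ≤ N) : 0 ≤ (t : ℝ) / N ∧ (t : ℝ) / N ≤ 1 := by
  have hN : (0 : ℝ) < N := Nat.cast_pos.2 (NeZero.pos N)
  exact ⟨by positivity, (div_le_one hN).2 (by exact_mod_cast ht)⟩

theorem sin_arcsin_sqrt_div {t : ℕ} (ht : t ≤ N) :
    Real.sin (Real.arcsin √((t : ℝ) / N)) = √((t : ℝ) / N) :=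
  Real.sin_arcsin (by linarith [Real.sqrt_nonneg ((t : ℝ) / N)])
    (Real.sqrt_le_one.2 (card_div_mem ht).2)

/-- With `sin θ = √(t/N)`, the hypothesis is the condition `1 ≤ M sin θ` of `sum_cos_sq_le`, up to
rounding `m` up to the number `M` of possible values of `j`. -/
theorem outcome_randomGrover_none_le (P : Fin N → Timed Bool) {m : ℝ}
    (hm : 1 ≤ m * √(((solutions P).card : ℝ) / N)) :
    (randomGrover P m).outcome none ≤ ENNReal.ofReal (3 / 4) := by
  have ht := card_solutions_le P
  have hsin := sin_arcsin_sqrt_div ht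
  set t := (solutions P).card
  set θ := Real.arcsin √((t : ℝ) / N) with hθ
  set M := ⌈m⌉₊ - 1 + 1 with hM
  have hmM : m ≤ M := (Nat.le_ceil m).trans (by rw [hM]; exact_mod_cast (by omega : ⌈m⌉₊ ≤ ⌈m⌉₊ - 1 + 1))
  have hpos : 0 < √((t : ℝ) / N) := by
    refine (Real.sqrt_nonneg _).lt_of_ne fun h => ?_
    rw [← h] at hm; norm_num at hm
  have hθ0 : 0 < θ := Real.arcsin_pos.2 hpos
  have hsum : ∑ x with (P x).val = true, ‖(uniformState N).1 x‖ ^ 2 = Real.sin θ ^ 2 := by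
    rw [sum_uniformState, hsin, Real.sq_sqrt (card_div_mem ht).1]
  have hle := sum_cos_sq_le hθ0 (Real.arcsin_le_pi_div_two _) (M := M)
    (by rw [hsin]; exact hm.trans (by gcongr))
  have hMpos : (0 : ℝ) < M := by rw [hM]; positivity
  rw [randomGrover, QProg.outcome_bind, PMF.bind_apply, QProg.outcome_uniform, tsum_fintype]
  have (j : Fin M) : PMF.uniformOfFintype (Fin M) j *
      (amplify (uniformState N) P j >>= fun x => verify P x).outcome none =
      ENNReal.ofReal ((M : ℝ)⁻¹ * Real.cos ((2 * (j : ℕ) + 1) * θ) ^ 2) := by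
    rw [outcome_bind_verify_none P _ fun x => x, outcome_amplify,
      measureState_groverState_compl _ _ θ hsum, PMF.uniformOfFintype_apply, Fintype.card_fin,
      ENNReal.ofReal_mul (by positivity), ENNReal.ofReal_inv_of_pos hMpos, ENNReal.ofReal_natCast]
  rw [Finset.sum_congr rfl fun j _ => this j, ← ENNReal.ofReal_sum_of_nonneg
    fun _ _ => by positivity]
  refine ENNReal.ofReal_le_ofReal ?_
  rw [Fin.sum_univ_eq_sum_range fun j => (M : ℝ)⁻¹ * Real.cos ((2 * (j : ℕ) + 1) * θ) ^ 2,
    ← Finset.mul_sum, inv_mul_le_iff₀ hMpos]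
  linarith

theorem expectedTime_randomGrover_le {P : Fin N → Timed Bool} {q : ℕ}
    (hq : ∀ x, (P x).time ≤ q) {m : ℝ} (hm : 1 ≤ m) :
    (randomGrover P m).expectedTime ≤ ENNReal.ofReal ((3 * q + 5) * m) := by
  have hj : ((⌈m⌉₊ - 1 : ℕ) : ℝ) ≤ m := by
    have h1 : 0 < ⌈m⌉₊ := Nat.ceil_pos.2 (by linarith)
    have := Nat.ceil_lt_add_one (by linarith : 0 ≤ m)
    rw [Nat.cast_sub h1]; push_cast; linarith
  have : (randomGrover P m).expectedTime ≤
      1 + (((2 + (⌈m⌉₊ - 1) * (2 * q + 2) : ℕ) : ℝ≥0∞) + q) := by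
    refine QProg.expectedTime_bind_le (QProg.expectedTime_uniform _).le fun j => ?_
    refine QProg.expectedTime_bind_le ((expectedTime_amplify_le _ P j q hq).trans ?_)
      (expectedTime_verify_le hq)
    have := Nat.le_of_lt_succ j.2
    gcongr
  refine this.trans ?_
  rw [← ENNReal.ofReal_natCast, ← ENNReal.ofReal_natCast, ← ENNReal.ofReal_one,
    ← ENNReal.ofReal_add (by positivity) (by positivity),
    ← ENNReal.ofReal_add (by positivity) (by positivity)]
  refine ENNReal.ofReal_le_ofReal ?_
  push_cast
  have hq0 : (0 : ℝ) ≤ q := Nat.cast_nonneg q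
  nlinarith [mul_nonneg (sub_nonneg.2 hj) hq0, mul_nonneg (sub_nonneg.2 hm) hq0]

/-! ### Exact search -/

theorem norm_sq_tiltedState_apply (β : ℝ) (z : Fin N × Bool) :
    ‖(tiltedState N β).1 z‖ ^ 2 =
      (N : ℝ)⁻¹ * (if z.2 = true then Real.sin β ^ 2 else Real.cos β ^ 2) := by
  have : (tiltedState N β).1 z = (((√(N : ℝ))⁻¹ * (if z.2 = true then Real.sin β
    else Real.cos β) : ℝ) : ℂ) := rfl
  rw [this, Complex.norm_real, Real.norm_eq_abs, sq_abs, mul_pow, inv_pow,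
    Real.sq_sqrt (Nat.cast_nonneg N)]
  split_ifs <;> rfl

theorem sum_tiltedState (P : Fin N → Timed Bool) (β : ℝ) :
    ∑ z : Fin N × Bool with ((P z.1).val && z.2) = true, ‖(tiltedState N β).1 z‖ ^ 2 =
      (solutions P).card / N * Real.sin β ^ 2 := by
  simp only [norm_sq_tiltedState_apply]
  rw [Finset.sum_filter, Fintype.sum_prod_type]
  simp only [Fintype.sum_bool, Bool.and_true, Bool.and_false, if_true, Bool.false_eq_true,
    if_false, add_zero]
  rw [← Finset.sum_filter, Finset.sum_const, nsmul_eq_mul, solutions]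
  ring

/-- A solution can be measured with the flag set, with factor `A`, or with the flag unset, with
factor `B`. Neither contribution depends on the solution, so this holds even when the guess `t` is
wrong. -/
theorem findsUniformly_exactGrover (P : Fin N → Timed Bool) (t : ℕ) :
    FindsUniformly P (exactGrover P t) := by
  unfold exactGrover
  refine FindsUniformly.bind fun _ => ?_
  set Q : Fin N × Bool → Timed Bool := fun z => do let b ← P z.1; Timed.op (b && z.2)
  set β := exactAngle N t
  set k := exactIterations N t
  obtain ⟨θ, hθ⟩ := exists_sin_sq_eq (tiltedState N β) fun z => (Q z).val
  obtain ⟨A, B, -, -, h⟩ := groverState_apply _ _ θ hθ k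
  have hx (x : Fin N) (hx : x ∈ solutions P) :
      (amplify (tiltedState N β) Q k >>= fun r => verify P r.1).outcome (some x) =
        ENNReal.ofReal (A ^ 2 * ((N : ℝ)⁻¹ * Real.sin β ^ 2)) +
          ENNReal.ofReal (B ^ 2 * ((N : ℝ)⁻¹ * Real.cos β ^ 2)) := by
    rw [mem_solutions] at hx
    have hQ1 : (Q (x, true)).val = true := by
      show ((P x).val && true) = true
      rw [hx]; rfl
    have hQ2 : (Q (x, false)).val = false := by
      show ((P x).val && false) = false
      rw [Bool.and_false]
    rw [outcome_bind_verify_some P _ Prod.fst, if_pos hx, Finset.sum_filter,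
      Fintype.sum_prod_type, Finset.sum_eq_single x (fun y _ hy => by simp [hy]) (by simp)]
    simp only [if_true, Fintype.sum_bool, outcome_amplify, measureState_apply, h, hQ1, hQ2,
      norm_mul, mul_pow, norm_sq_tiltedState_apply, Complex.norm_real, Real.norm_eq_abs, sq_abs,
      Bool.false_eq_true, if_false]
  refine ⟨fun x h => ?_, fun x y h1 h2 => by rw [hx x h1, hx y h2]⟩
  rw [mem_solutions] at h
  rw [outcome_bind_verify_some P _ Prod.fst, if_neg h]

/-- This is what the ceiling in `exactIterations` is for: the target angle is at most `θ`, so the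
extra qubit only has to lower the amplitude and the arcsine in `exactAngle` has an argument at most
`1`. -/
theorem pi_div_exactIterations_le {t : ℕ} (ht : 0 < t) :
    Real.pi / (4 * exactIterations N t + 2) ≤ Real.arcsin √((t : ℝ) / N) := by
  have hN : (0 : ℝ) < N := Nat.cast_pos.2 (NeZero.pos N)
  have hθ : 0 < Real.arcsin √((t : ℝ) / N) := Real.arcsin_pos.2 (by positivity)
  have := Nat.le_ceil (Real.pi / (4 * Real.arcsin √((t : ℝ) / N)) - 1 / 2)
  rw [← exactIterations] at this
  rw [div_le_iff₀ (by positivity)]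
  rw [sub_le_iff_le_add, div_le_iff₀ (by positivity)] at this
  linarith

theorem sin_exactAngle {t : ℕ} (ht : 0 < t) (htN : t ≤ N) :
    √((t : ℝ) / N) * Real.sin (exactAngle N t) =
      Real.sin (Real.pi / (4 * exactIterations N t + 2)) := by
  have hN : (0 : ℝ) < N := Nat.cast_pos.2 (NeZero.pos N)
  have hpos : 0 < √((t : ℝ) / N) := by positivity
  have h0 : 0 ≤ Real.sin (Real.pi / (4 * exactIterations N t + 2)) := by
    refine Real.sin_nonneg_of_nonneg_of_le_pi (by positivity) ?_
    exact div_le_self Real.pi_pos.le (by linarith [(Nat.cast_nonneg _ : (0 : ℝ) ≤ exactIterations N t)])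
  rw [exactAngle, Real.sin_arcsin]
  · field_simp
  · exact (by norm_num : (-1 : ℝ) ≤ 0).trans (by positivity)
  · rw [div_le_one hpos, ← sin_arcsin_sqrt_div htN]
    refine Real.sin_le_sin_of_le_of_le_pi_div_two ?_ (Real.arcsin_le_pi_div_two _)
      (pi_div_exactIterations_le ht)
    exact le_trans (by linarith [Real.pi_pos]) (by positivity : (0 : ℝ) ≤ _)

/-- Starting from the angle `π/(4k+2)`, `k` iterations reach exactly `π/2`, where the failure
amplitude vanishes. -/
theorem outcome_exactGrover_none {P : Fin N → Timed Bool} {t : ℕ} (h : (solutions P).card = t)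
    (ht : 0 < t) : (exactGrover P t).outcome none = 0 := by
  have htN : t ≤ N := h ▸ card_solutions_le P
  have hN : (0 : ℝ) < N := Nat.cast_pos.2 (NeZero.pos N)
  rw [exactGrover, QProg.outcome_run_bind, outcome_bind_verify_none P _ Prod.fst,
    outcome_amplify]
  have hsum : ∑ z : Fin N × Bool with ((P z.1).val && z.2) = true,
      ‖(tiltedState N (exactAngle N t)).1 z‖ ^ 2 =
        Real.sin (Real.pi / (4 * exactIterations N t + 2)) ^ 2 := by
    rw [sum_tiltedState, ← sin_exactAngle ht htN, h, mul_pow, Real.sq_sqrt (by positivity)]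
  have key := measureState_groverState_compl _ _ _ hsum (exactIterations N t)
  have : (2 * (exactIterations N t : ℝ) + 1) * (Real.pi / (4 * exactIterations N t + 2)) =
      Real.pi / 2 := by field_simp; ring
  rw [this, Real.cos_pi_div_two, zero_pow two_ne_zero, ENNReal.ofReal_zero] at key
  refine le_antisymm (le_trans ?_ key.le) zero_le
  -- An outcome rejected by `verify` is in particular unmarked; an unmarked outcome may still pass,
  -- when only its flag is unset.
  refine Finset.sum_le_sum_of_subset ?_
  intro z
  simp only [Finset.mem_filter, Finset.mem_univ, true_and]
  intro hz hz'
  rw [Bool.and_eq_true] at hz'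
  exact hz hz'.1

/-- From `θ ≥ sin θ = √(t/N)` one gets `π/(4θ) ≤ (π/4) √(N/t)`; rounding adds at most `1/2`,
absorbed by `√(N/t) ≥ 1`. -/
theorem exactIterations_le {t : ℕ} (ht : 0 < t) (htN : t ≤ N) :
    (exactIterations N t : ℝ) ≤ 2 * √((N : ℝ) / t) := by
  have hN : (0 : ℝ) < N := Nat.cast_pos.2 (NeZero.pos N)
  have ht' : (0 : ℝ) < t := Nat.cast_pos.2 ht
  have hpos : 0 < √((t : ℝ) / N) := by positivity
  set θ := Real.arcsin √((t : ℝ) / N) with hθ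
  have hθ0 : 0 < θ := Real.arcsin_pos.2 hpos
  have hθ1 : √((t : ℝ) / N) ≤ θ := by
    have := Real.sin_le hθ0.le
    rwa [hθ, sin_arcsin_sqrt_div htN] at this
  have h1 : 1 ≤ √((N : ℝ) / t) := Real.one_le_sqrt.2 ((one_le_div ht').2 (by exact_mod_cast htN))
  have h2 : Real.pi / (4 * θ) ≤ Real.pi / 4 * √((N : ℝ) / t) := by
    have : √((N : ℝ) / t) = (√((t : ℝ) / N))⁻¹ := by rw [← Real.sqrt_inv, inv_div]
    rw [this, ← div_eq_mul_inv, div_div]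
    gcongr
  have h3 : 1 / 2 ≤ Real.pi / (4 * θ) := by
    rw [div_le_div_iff₀ two_pos (by positivity)]
    have := Real.arcsin_le_pi_div_two √((t : ℝ) / N)
    rw [← hθ] at this
    linarith
  have := Nat.ceil_lt_add_one (a := Real.pi / (4 * θ) - 1 / 2) (by linarith)
  rw [hθ, ← exactIterations, ← hθ] at this
  nlinarith [Real.pi_lt_four]

theorem expectedTime_exactGrover_le {P : Fin N → Timed Bool} {q : ℕ}
    (hq : ∀ x, (P x).time ≤ q) {t : ℕ} (ht : 0 < t) (htN : t ≤ N) :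
    (exactGrover P t).expectedTime ≤ ENNReal.ofReal ((5 * q + 11) * √((N : ℝ) / t)) := by
  have : (exactGrover P t).expectedTime ≤
      (1 : ℕ) + (((2 + exactIterations N t * (2 * (q + 1) + 2) : ℕ) : ℝ≥0∞) + q) := by
    rw [exactGrover, QProg.expectedTime_run_bind]
    refine add_le_add le_rfl (QProg.expectedTime_bind_le ?_ fun r => expectedTime_verify_le hq _)
    exact expectedTime_amplify_le _ _ _ _ fun z => Nat.add_le_add_right (hq z.1) 1
  refine this.trans ?_
  have h0 := exactIterations_le ht htN
  have ht' : (0 : ℝ) < t := Nat.cast_pos.2 ht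
  have h1 : 1 ≤ √((N : ℝ) / t) := Real.one_le_sqrt.2 ((one_le_div ht').2 (by exact_mod_cast htN))
  rw [← Nat.cast_add, ← Nat.cast_add, ← ENNReal.ofReal_natCast]
  refine ENNReal.ofReal_le_ofReal ?_
  push_cast
  have hq0 : (0 : ℝ) ≤ q := Nat.cast_nonneg q
  nlinarith [mul_nonneg (sub_nonneg.2 h0) hq0, mul_nonneg (sub_nonneg.2 h1) hq0]

end Search
end QSP
namespace QSP

/-! ### Sequences of attempts that succeed with constant probability from some stage on -/

namespace QProg

variable {α : Type}

theorem prod_map_range_le_pow {a : ℕ → ℝ≥0∞} {r : ℝ≥0∞} {k₀ : ℕ} (h1 : ∀ k, a k ≤ 1)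
    (h2 : ∀ k, k₀ ≤ k → a k ≤ r) (n : ℕ) : ((List.range n).map a).prod ≤ r ^ (n - k₀) := by
  induction n with
  | zero => simp
  | succ n ih =>
    rw [List.range_succ, List.map_append, List.prod_append, List.map_singleton,
      List.prod_singleton]
    rcases lt_or_ge n k₀ with h | h
    · rw [show n + 1 - k₀ = n - k₀ by omega]
      exact (mul_le_mul' ih (h1 n)).trans (mul_one _).le
    · rw [show n + 1 - k₀ = (n - k₀) + 1 by omega, pow_succ]
      exact mul_le_mul' ih (h2 n h)

theorem sum_map_range (a : ℕ → ℝ≥0∞) (n : ℕ) :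
    ((List.range n).map a).sum = ∑ k ∈ Finset.range n, a k := by
  induction n with
  | zero => simp
  | succ n ih => rw [List.range_succ, List.map_append, List.sum_append, ih,
      Finset.sum_range_succ, List.map_singleton, List.sum_singleton]

theorem expectedTime_firstSome_concat (ps : List (QProg (Option α))) (p : QProg (Option α)) :
    (firstSome (ps ++ [p])).expectedTime =
      (firstSome ps).expectedTime + (firstSome ps).outcome none * p.expectedTime := by
  induction ps with
  | nil =>
    rw [List.nil_append, expectedTime_firstSome_cons, expectedTime_firstSome_nil]
    simp [firstSome, outcome_pure]
  | cons q ps ih =>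
    rw [List.cons_append, expectedTime_firstSome_cons, ih, expectedTime_firstSome_cons,
      outcome_firstSome_cons_none, mul_add, add_assoc, mul_assoc]

/-- Stage `k` is paid for only if all earlier stages failed. Stages before `k₀` contribute the
trivial factor `1`, which the truncated subtraction `k - k₀` encodes. -/
theorem expectedTime_firstSome_range_le (p : ℕ → QProg (Option α)) {r : ℝ≥0∞} {k₀ : ℕ}
    (h2 : ∀ k, k₀ ≤ k → (p k).outcome none ≤ r) (n : ℕ) :
    (firstSome ((List.range n).map p)).expectedTime ≤
      ∑ k ∈ Finset.range n, r ^ (k - k₀) * (p k).expectedTime := by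
  induction n with
  | zero => simp [expectedTime_firstSome_nil]
  | succ n ih =>
    rw [List.range_succ, List.map_append, List.map_singleton, expectedTime_firstSome_concat,
      Finset.sum_range_succ, outcome_firstSome_none, List.map_map]
    gcongr
    exact prod_map_range_le_pow (fun k => (p k).outcome.coe_le_one _) h2 n

end QProg

/-! ### Failure probability and expected time of `bbht` -/

section Search

variable {N : ℕ}

theorem one_le_sqrt_div {t : ℕ} (ht : 0 < t) (htN : t ≤ N) : 1 ≤ √((N : ℝ) / t) :=
  Real.one_le_sqrt.2 ((one_le_div (Nat.cast_pos.2 ht)).2 (by exact_mod_cast htN))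

/-- The critical round: from `k₀` on the bound `3/4` applies, and `(8/7) ^ k₀` overshoots `√(N/t)`
by at most one factor `8/7`. -/
theorem exists_threshold {t : ℕ} (ht : 0 < t) (htN : t ≤ N) :
    ∃ k₀ : ℕ, √((N : ℝ) / t) ≤ (8 / 7 : ℝ) ^ k₀ ∧ (8 / 7 : ℝ) ^ k₀ ≤ 8 / 7 * √((N : ℝ) / t) := by
  obtain ⟨k, h1, h2⟩ := exists_nat_pow_near (one_le_sqrt_div ht htN)
    (by norm_num : (1 : ℝ) < 8 / 7)
  exact ⟨k + 1, h2.le, by rw [pow_succ']; gcongr⟩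

variable [NeZero N]

theorem sum_geometric_le (n : ℕ) : ∑ k ∈ Finset.range n, (8 / 7 : ℝ) ^ k ≤ 7 * (8 / 7) ^ n := by
  induction n with
  | zero => norm_num
  | succ n ih => rw [Finset.sum_range_succ, pow_succ]; linarith

/-- The terms grow by `8/7` up to `k₀` and then shrink by `3/4 · 8/7 = 6/7`. Each of the two
geometric sums contributes at most `7 (8/7) ^ k₀`, as `1/(8/7 - 1) = 1/(1 - 6/7) = 7`. -/
theorem sum_geometric_damped_le (k₀ n : ℕ) :
    ∑ k ∈ Finset.range n, (3 / 4 : ℝ) ^ (k - k₀) * (8 / 7) ^ k ≤ 14 * (8 / 7) ^ k₀ := by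
  have hlow (n : ℕ) (h : n ≤ k₀) :
      ∑ k ∈ Finset.range n, (3 / 4 : ℝ) ^ (k - k₀) * (8 / 7) ^ k ≤ 7 * (8 / 7) ^ n := by
    refine le_trans (Finset.sum_le_sum fun k hk => ?_) (sum_geometric_le n)
    rw [Finset.mem_range] at hk
    rw [show k - k₀ = 0 by omega, pow_zero, one_mul]
  have hhigh (d : ℕ) : ∑ k ∈ Finset.range (k₀ + d), (3 / 4 : ℝ) ^ (k - k₀) * (8 / 7) ^ k ≤
      14 * (8 / 7) ^ k₀ - 7 * (8 / 7) ^ k₀ * (6 / 7) ^ d := by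
    induction d with
    | zero => rw [add_zero, pow_zero]; linarith [hlow k₀ le_rfl]
    | succ d ih =>
      rw [← add_assoc, Finset.sum_range_succ, Nat.add_sub_cancel_left, pow_add]
      have : (3 / 4 : ℝ) ^ d * ((8 / 7) ^ k₀ * (8 / 7) ^ d) = (8 / 7) ^ k₀ * (6 / 7) ^ d := by
        rw [mul_left_comm, ← mul_pow]; norm_num
      rw [this, pow_succ]
      linarith
  rcases le_total n k₀ with h | h
  · have := pow_le_pow_right₀ (by norm_num : (1 : ℝ) ≤ 8 / 7) h
    have := hlow n h
    have : (0 : ℝ) ≤ (8 / 7) ^ k₀ := by positivity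
    linarith
  · obtain ⟨d, rfl⟩ := Nat.exists_eq_add_of_le h
    exact (hhigh d).trans (sub_le_self _ (by positivity))

theorem sqrt_div_mul_sqrt_div {t : ℕ} (ht : 0 < t) : √((N : ℝ) / t) * √((t : ℝ) / N) = 1 := by
  have hN : (0 : ℝ) < N := Nat.cast_pos.2 (NeZero.pos N)
  have ht' : (0 : ℝ) < t := Nat.cast_pos.2 ht
  rw [← Real.sqrt_mul (by positivity), div_mul_div_comm, mul_comm, div_self (by positivity),
    Real.sqrt_one]

theorem outcome_randomGrover_none_le_of_threshold {P : Fin N → Timed Bool} {k₀ : ℕ}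
    (ht : 0 < (solutions P).card) (hk₀ : √((N : ℝ) / (solutions P).card) ≤ (8 / 7 : ℝ) ^ k₀)
    (k : ℕ) (hk : k₀ ≤ k) :
    (randomGrover P ((8 / 7 : ℝ) ^ k)).outcome none ≤ ENNReal.ofReal (3 / 4) := by
  refine outcome_randomGrover_none_le P ?_
  rw [← sqrt_div_mul_sqrt_div (N := N) ht]
  gcongr
  exact hk₀.trans (pow_le_pow_right₀ (by norm_num) hk)

/-- The number of values of `m` in `bbht`. -/
noncomputable def bbhtRounds (N : ℕ) : ℕ := ⌊Real.logb (8 / 7) (2 * √(N : ℝ))⌋₊ + 1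

theorem lt_pow_bbhtRounds : 2 * √(N : ℝ) < (8 / 7 : ℝ) ^ bbhtRounds N := by
  have hN : (0 : ℝ) < N := Nat.cast_pos.2 (NeZero.pos N)
  have := Nat.lt_floor_add_one (Real.logb (8 / 7) (2 * √(N : ℝ)))
  rwa [Real.logb_lt_iff_lt_rpow (by norm_num) (by positivity), ← Nat.cast_add_one,
    Real.rpow_natCast] at this

theorem pow_bbhtRounds_le : (8 / 7 : ℝ) ^ bbhtRounds N ≤ 8 / 7 * (2 * √(N : ℝ)) := by
  have hN : (1 : ℝ) ≤ N := Nat.one_le_cast.2 (NeZero.pos N)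
  have h1 : 1 ≤ √(N : ℝ) := Real.one_le_sqrt.2 hN
  have := Nat.floor_le (Real.logb_nonneg (by norm_num : (1 : ℝ) < 8 / 7)
    (by linarith : 1 ≤ 2 * √(N : ℝ)))
  rw [Real.le_logb_iff_rpow_le (by norm_num) (by positivity), Real.rpow_natCast] at this
  rw [bbhtRounds, pow_succ']
  gcongr

theorem findsUniformly_bbht (P : Fin N → Timed Bool) : FindsUniformly P (bbht P) := by
  refine FindsUniformly.firstSome fun p hp => ?_
  obtain ⟨k, -, rfl⟩ := List.mem_map.1 hp
  exact findsUniformly_randomGrover P _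

/-- Past the critical round there remain `d` rounds with `(8/7) ^ d ≥ (7/4) √t`. Since `3/4 ≤
(7/8)²`, they all fail with probability at most `(8/7) ^ (-2d) ≤ 16/(49 t)`, which is below
`1/(3t)`. -/
theorem outcome_bbht_none_le {P : Fin N → Timed Bool} (ht : 0 < (solutions P).card) :
    (bbht P).outcome none ≤ ENNReal.ofReal (1 / (3 * (solutions P).card)) := by
  have htN := card_solutions_le P
  obtain ⟨k₀, h1, h2⟩ := exists_threshold ht htN
  have hr := fun k => outcome_randomGrover_none_le_of_threshold ht h1 k
  set t := (solutions P).card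
  have hN : (0 : ℝ) < N := Nat.cast_pos.2 (NeZero.pos N)
  have ht' : (0 : ℝ) < t := Nat.cast_pos.2 ht
  have h3 := lt_pow_bbhtRounds (N := N)
  have h4 : √((N : ℝ) / t) ≤ √N := Real.sqrt_le_sqrt (div_le_self hN.le (by exact_mod_cast ht))
  have hk : k₀ ≤ bbhtRounds N := by
    by_contra hcon
    have := pow_le_pow_right₀ (by norm_num : (1 : ℝ) ≤ 8 / 7) (not_le.1 hcon).le
    nlinarith [Real.sqrt_nonneg (N : ℝ)]
  rw [bbht, ← bbhtRounds, QProg.outcome_firstSome_none, List.map_map]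
  refine (QProg.prod_map_range_le_pow (fun k => PMF.coe_le_one _ _) hr _).trans ?_
  rw [← ENNReal.ofReal_pow (by norm_num)]
  refine ENNReal.ofReal_le_ofReal ?_
  obtain ⟨d, hd⟩ := Nat.exists_eq_add_of_le hk
  rw [hd, Nat.add_sub_cancel_left]
  rw [hd, pow_add] at h3
  -- The constant is `2 / (8/7)`: the rounds extend past `2√N = 2 √(N/t) √t`, and the critical one
  -- is at most `8/7 · √(N/t)`.
  have h5 : 7 / 4 * √(t : ℝ) ≤ (8 / 7) ^ d := by
    have e : √(N : ℝ) = √((N : ℝ) / t) * √t := by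
      rw [← Real.sqrt_mul (by positivity), div_mul_cancel₀ _ ht'.ne']
    have hp : 0 < √((N : ℝ) / t) := by positivity
    rw [e] at h3
    by_contra hcon
    have h6 : (8 / 7 : ℝ) ^ k₀ * (8 / 7) ^ d ≤ 8 / 7 * √((N : ℝ) / t) * (7 / 4 * √t) :=
      mul_le_mul h2 (not_le.1 hcon).le (by positivity) (by positivity)
    linarith
  have h7 : 3 * (t : ℝ) ≤ ((8 / 7) ^ d) ^ 2 := by
    have := mul_self_le_mul_self (by positivity) h5
    nlinarith [Real.mul_self_sqrt ht'.le]
  calc (3 / 4 : ℝ) ^ d ≤ ((7 / 8) ^ 2) ^ d := by gcongr; norm_num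
    _ = 1 / ((8 / 7) ^ d) ^ 2 := by
      rw [pow_right_comm, ← one_div_pow, ← one_div_pow]; norm_num
    _ ≤ 1 / (3 * t) := by gcongr

theorem expectedTime_bbht_le {P : Fin N → Timed Bool} {q : ℕ} (hq : ∀ x, (P x).time ≤ q) :
    (bbht P).expectedTime ≤ ENNReal.ofReal (16 * (3 * q + 5) * √N) := by
  rw [bbht, ← bbhtRounds]
  refine (QProg.expectedTime_firstSome_range_le _ (r := 1) (k₀ := 0)
    (fun k _ => PMF.coe_le_one _ _) _).trans ?_
  refine (Finset.sum_le_sum (g := fun k : ℕ => ENNReal.ofReal ((3 * q + 5) * (8 / 7) ^ k))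
    fun k _ => ?_).trans ?_
  · rw [one_pow, one_mul]
    exact expectedTime_randomGrover_le hq (one_le_pow₀ (by norm_num))
  · rw [← ENNReal.ofReal_sum_of_nonneg fun _ _ => by positivity, ← Finset.mul_sum]
    refine ENNReal.ofReal_le_ofReal ?_
    calc (3 * q + 5) * ∑ k ∈ Finset.range (bbhtRounds N), (8 / 7 : ℝ) ^ k
        ≤ (3 * q + 5) * (7 * (8 / 7 * (2 * √(N : ℝ)))) := by
          gcongr
          exact (sum_geometric_le _).trans (by gcongr; exact pow_bbhtRounds_le)
      _ = _ := by ring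

/-- The damped sum replaces the full geometric sum of `expectedTime_bbht_le`, so the critical round
sets the cost; `16 = 14 · 8/7`. -/
theorem expectedTime_bbht_le_of_pos {P : Fin N → Timed Bool} {q : ℕ}
    (hq : ∀ x, (P x).time ≤ q) (ht : 0 < (solutions P).card) :
    (bbht P).expectedTime ≤
      ENNReal.ofReal (16 * (3 * q + 5) * √((N : ℝ) / (solutions P).card)) := by
  obtain ⟨k₀, h1, h2⟩ := exists_threshold ht (card_solutions_le P)
  rw [bbht]
  refine (QProg.expectedTime_firstSome_range_le _
    (outcome_randomGrover_none_le_of_threshold ht h1) _).trans ?_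
  refine (Finset.sum_le_sum (g := fun k : ℕ =>
    ENNReal.ofReal ((3 * q + 5) * ((3 / 4) ^ (k - k₀) * (8 / 7) ^ k))) fun k _ => ?_).trans ?_
  · rw [mul_left_comm, ENNReal.ofReal_mul (by positivity), ENNReal.ofReal_pow (by norm_num)]
    gcongr
    exact expectedTime_randomGrover_le hq (one_le_pow₀ (by norm_num))
  · rw [← ENNReal.ofReal_sum_of_nonneg fun _ _ => by positivity, ← Finset.mul_sum]
    refine ENNReal.ofReal_le_ofReal ?_
    calc _ ≤ (3 * q + 5) * (14 * (8 / 7 * √((N : ℝ) / (solutions P).card))) := by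
          gcongr
          exact (sum_geometric_damped_le _ _).trans (by gcongr)
      _ = _ := by ring

/-! ### Failure probability and expected time of `bcwz` -/

/-- The number `t₀` of exact searches of `bcwz`. -/
noncomputable def exactSearches (N : ℕ) (εinv : ℝ) : ℕ := min N ⌈Real.logb 2 εinv⌉₊

theorem exactSearches_le (N : ℕ) (εinv : ℝ) : exactSearches N εinv ≤ N := min_le_left _ _

theorem exactSearches_pos {εinv : ℝ} (hε : 1 < εinv) : 0 < exactSearches N εinv :=
  lt_min (NeZero.pos N) (Nat.ceil_pos.2 (Real.logb_pos (by norm_num) hε))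

theorem findsUniformly_bcwz (P : Fin N → Timed Bool) (εinv : ℝ) :
    FindsUniformly P (bcwz P εinv) := by
  refine FindsUniformly.firstSome fun p hp => ?_
  rcases List.mem_append.1 hp with hp | hp
  · obtain ⟨k, -, rfl⟩ := List.mem_map.1 hp
    exact findsUniformly_exactGrover P _
  · rw [List.eq_of_mem_replicate hp]
    exact findsUniformly_randomGrover P _

/-- Up to `t₀` solutions, one of the exact searches guesses their number and succeeds with
certainty. With more, each of the `3 t₀` random searches fails with probability at most `3/4`, and
`(3/4)³ < 1/2`. -/
theorem outcome_bcwz_none_le {P : Fin N → Timed Bool} {εinv : ℝ} (hε : 1 < εinv)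
    (ht : 0 < (solutions P).card) : (bcwz P εinv).outcome none ≤ ENNReal.ofReal (1 / εinv) := by
  have htN := card_solutions_le P
  have h0 := exactSearches_pos (N := N) hε
  have hdef : exactSearches N εinv = min N ⌈Real.logb 2 εinv⌉₊ := rfl
  rw [bcwz, ← exactSearches, QProg.outcome_firstSome_none]
  set t₀ := exactSearches N εinv
  rcases le_or_gt (solutions P).card t₀ with h | h
  · rw [List.prod_eq_zero]
    · exact zero_le
    · rw [List.mem_map]
      refine ⟨exactGrover P ((solutions P).card - 1 + 1), List.mem_append_left _ ?_, ?_⟩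
      · exact List.mem_map.2 ⟨(solutions P).card - 1, List.mem_range.2 (by omega), rfl⟩
      · exact outcome_exactGrover_none (by omega) (by omega)
  · rw [List.map_append, List.prod_append, List.map_replicate, List.prod_replicate]
    rw [List.map_map]
    refine (mul_le_of_le_one_left zero_le ((QProg.prod_map_range_le_pow (r := 1) (k₀ := 0)
      (fun k => PMF.coe_le_one _ _) (fun k _ => PMF.coe_le_one _ _) _).trans_eq
        (one_pow _))).trans ?_
    have hr : (randomGrover P √((N : ℝ) / t₀)).outcome none ≤ ENNReal.ofReal (3 / 4) := by
      refine outcome_randomGrover_none_le P ?_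
      rw [← sqrt_div_mul_sqrt_div (N := N) ht]
      have : (0 : ℝ) < t₀ := Nat.cast_pos.2 h0
      gcongr
    calc _ ≤ ENNReal.ofReal (3 / 4) ^ (3 * t₀) := by gcongr
      _ = ENNReal.ofReal ((3 / 4) ^ (3 * t₀)) := by rw [ENNReal.ofReal_pow (by norm_num)]
      _ ≤ ENNReal.ofReal (1 / εinv) := by
        refine ENNReal.ofReal_le_ofReal ?_
        -- More than `t₀` solutions exist among `N` elements, so the minimum defining `t₀` is not
        -- `N`.
        have hlog : Real.logb 2 εinv ≤ t₀ := by
          have : t₀ = ⌈Real.logb 2 εinv⌉₊ := by omega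
          rw [this]
          exact Nat.le_ceil _
        rw [Real.logb_le_iff_le_rpow (by norm_num) (by linarith), Real.rpow_natCast] at hlog
        calc (3 / 4 : ℝ) ^ (3 * t₀) = (27 / 64) ^ t₀ := by rw [pow_mul]; norm_num
          _ ≤ (1 / 2) ^ t₀ := pow_le_pow_left₀ (by norm_num) (by norm_num) _
          _ = 1 / 2 ^ t₀ := by rw [one_div_pow]
          _ ≤ 1 / εinv := by gcongr

theorem sum_one_div_sqrt_le (n : ℕ) :
    ∑ k ∈ Finset.range n, 1 / √((k + 1 : ℕ) : ℝ) ≤ 2 * √n := by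
  induction n with
  | zero => simp
  | succ n ih =>
    rw [Finset.sum_range_succ]
    have h1 : 0 < √((n + 1 : ℕ) : ℝ) := by positivity
    have h2 : 1 / √((n + 1 : ℕ) : ℝ) ≤ 2 * √((n + 1 : ℕ) : ℝ) - 2 * √(n : ℝ) := by
      rw [div_le_iff₀ h1]
      have e1 := Real.mul_self_sqrt (Nat.cast_nonneg (α := ℝ) n)
      have e2 := Real.mul_self_sqrt (Nat.cast_nonneg (α := ℝ) (n + 1))
      push_cast at e2 ⊢
      nlinarith [sq_nonneg (√((n : ℝ) + 1) - √(n : ℝ))]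
    linarith

theorem le_sum_one_div_sqrt (n : ℕ) :
    2 * √((n + 1 : ℕ) : ℝ) - 2 ≤ ∑ k ∈ Finset.range n, 1 / √((k + 1 : ℕ) : ℝ) := by
  induction n with
  | zero => simp
  | succ n ih =>
    rw [Finset.sum_range_succ]
    have h1 : 0 < √((n + 1 : ℕ) : ℝ) := by positivity
    have h2 : 2 * √((n + 1 + 1 : ℕ) : ℝ) - 2 * √((n + 1 : ℕ) : ℝ) ≤ 1 / √((n + 1 : ℕ) : ℝ) := by
      rw [le_div_iff₀ h1]
      have e1 := Real.mul_self_sqrt (Nat.cast_nonneg (α := ℝ) (n + 1))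
      have e2 := Real.mul_self_sqrt (Nat.cast_nonneg (α := ℝ) (n + 1 + 1))
      have e3 : ((n + 1 + 1 : ℕ) : ℝ) = ((n + 1 : ℕ) : ℝ) + 1 := by push_cast; ring
      nlinarith [sq_nonneg (√((n + 1 + 1 : ℕ) : ℝ) - √((n + 1 : ℕ) : ℝ))]
    linarith

/-- Both halves cost `O(√(N t₀))`: the exact searches because `∑ 1/√t ≤ 2√t₀`, the random ones
because `t₀ √(N/t₀) = √(N t₀)`. -/
theorem expectedTime_bcwz_le {P : Fin N → Timed Bool} {q : ℕ} (hq : ∀ x, (P x).time ≤ q)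
    {εinv : ℝ} (hε : 1 < εinv) : (bcwz P εinv).expectedTime ≤
      ENNReal.ofReal ((19 * q + 37) * √(N * exactSearches N εinv)) := by
  have h0 := exactSearches_pos (N := N) hε
  have h1 := exactSearches_le N εinv
  rw [bcwz, ← exactSearches]
  set t₀ := exactSearches N εinv
  have ht : (0 : ℝ) < t₀ := Nat.cast_pos.2 h0
  refine (QProg.expectedTime_firstSome_le_sum _).trans ?_
  rw [List.map_append, List.sum_append, List.map_map, List.map_replicate, List.sum_replicate,
    QProg.sum_map_range]
  simp only [Function.comp_apply]
  have hA : ∑ t ∈ Finset.range t₀, (exactGrover P (t + 1)).expectedTime ≤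
      ENNReal.ofReal ((5 * q + 11) * (2 * √(N * t₀))) := by
    refine (Finset.sum_le_sum fun t ht => expectedTime_exactGrover_le hq t.succ_pos
      (by rw [Finset.mem_range] at ht; omega)).trans ?_
    rw [← ENNReal.ofReal_sum_of_nonneg fun _ _ => by positivity, ← Finset.mul_sum]
    refine ENNReal.ofReal_le_ofReal ?_
    gcongr
    have := sum_one_div_sqrt_le t₀
    calc _ = √(N : ℝ) * ∑ k ∈ Finset.range t₀, 1 / √((k + 1 : ℕ) : ℝ) := by
          rw [Finset.mul_sum]
          refine Finset.sum_congr rfl fun k _ => ?_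
          rw [Real.sqrt_div (Nat.cast_nonneg N), mul_one_div]
      _ ≤ √(N : ℝ) * (2 * √t₀) := by gcongr
      _ = _ := by rw [Real.sqrt_mul (Nat.cast_nonneg N)]; ring
  have hB : (3 * t₀) • (randomGrover P √((N : ℝ) / t₀)).expectedTime ≤
      ENNReal.ofReal (3 * ((3 * q + 5) * √(N * t₀))) := by
    rw [nsmul_eq_mul]
    calc _ ≤ ((3 * t₀ : ℕ) : ℝ≥0∞) * ENNReal.ofReal ((3 * q + 5) * √((N : ℝ) / t₀)) := by
          gcongr
          exact expectedTime_randomGrover_le hq (one_le_sqrt_div h0 h1)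
      _ = ENNReal.ofReal (3 * ((3 * q + 5) * (t₀ * √((N : ℝ) / t₀)))) := by
          rw [← ENNReal.ofReal_natCast, ← ENNReal.ofReal_mul (by positivity)]
          push_cast
          ring_nf
      _ = _ := by
          congr 3
          have : √((N : ℝ) * t₀) = √((t₀ : ℝ) ^ 2 * (N / t₀)) := by
            congr 1; field_simp
          rw [this, Real.sqrt_mul (by positivity), Real.sqrt_sq ht.le]
  refine (add_le_add hA hB).trans ?_
  rw [← ENNReal.ofReal_add (by positivity) (by positivity)]
  refine ENNReal.ofReal_le_ofReal ?_
  linarith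

/-! ### `findsol` -/

theorem findsUniformly_findsol (P : Fin N → Timed Bool) (εinv : ℝ) :
    FindsUniformly P (findsol P εinv) := by
  refine FindsUniformly.firstSome ?_
  simp only [List.forall_mem_cons, List.not_mem_nil, false_imp_iff, implies_true, and_true]
  exact ⟨findsUniformly_bbht P, findsUniformly_bbht P, findsUniformly_bcwz P εinv⟩

/-- Running `bbht` twice squares its `1/(3t)`. The resulting decay `1/t²` is summable over the ranks
visited by `minfind`; a single run would leave a harmonic sum. -/
theorem outcome_findsol_none_le {P : Fin N → Timed Bool} {εinv : ℝ} (hε : 1 < εinv)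
    (ht : 0 < (solutions P).card) : (findsol P εinv).outcome none ≤
      ENNReal.ofReal (1 / (9 * (solutions P).card ^ 2) * (1 / εinv)) := by
  rw [findsol, QProg.outcome_firstSome_none]
  simp only [List.map_cons, List.map_nil, List.prod_cons, List.prod_nil, mul_one]
  have h1 := outcome_bbht_none_le ht
  refine (mul_le_mul' h1 (mul_le_mul' h1 (outcome_bcwz_none_le hε ht))).trans_eq ?_
  rw [← ENNReal.ofReal_mul (by positivity), ← ENNReal.ofReal_mul (by positivity)]
  congr 1
  field_simp
  norm_num

theorem expectedTime_findsol (P : Fin N → Timed Bool) (εinv : ℝ) :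
    (findsol P εinv).expectedTime = (bbht P).expectedTime +
      (bbht P).outcome none * ((bbht P).expectedTime +
        (bbht P).outcome none * (bcwz P εinv).expectedTime) := by
  rw [findsol]
  simp only [QProg.expectedTime_firstSome_cons, QProg.expectedTime_firstSome_nil, mul_zero,
    add_zero]

/-- The expensive `bcwz` is weighted with the failure of `bbht`. One failure suffices here, since
`1/(3t) ≤ 1/√t`. The maximum with `1` covers the case of no solution, where everything is run. -/
theorem expectedTime_findsol_le {P : Fin N → Timed Bool} {q : ℕ} (hq : ∀ x, (P x).time ≤ q)
    {εinv : ℝ} (hε : 1 < εinv) : (findsol P εinv).expectedTime ≤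
      ENNReal.ofReal ((115 * q + 197) * √(N * exactSearches N εinv) /
        √((max (solutions P).card 1 : ℕ) : ℝ)) := by
  have h0 := exactSearches_pos (N := N) hε
  have hc := expectedTime_bcwz_le hq hε
  rw [expectedTime_findsol]
  set t₀ := exactSearches N εinv
  have hQ : √(N : ℝ) ≤ √(N * t₀) := Real.sqrt_le_sqrt
    (le_mul_of_one_le_right (Nat.cast_nonneg N) (by exact_mod_cast h0))
  rcases Nat.eq_zero_or_pos (solutions P).card with ht | ht
  · have hb := expectedTime_bbht_le hq
    rw [ht, zero_max, Nat.cast_one, Real.sqrt_one, div_one]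
    calc _ ≤ ENNReal.ofReal (16 * (3 * q + 5) * √N) + 1 * (ENNReal.ofReal (16 * (3 * q + 5) * √N)
          + 1 * ENNReal.ofReal ((19 * q + 37) * √(N * t₀))) := by
          gcongr <;> exact PMF.coe_le_one _ _
      _ ≤ _ := by
          rw [one_mul, one_mul, ← ENNReal.ofReal_add (by positivity) (by positivity),
            ← ENNReal.ofReal_add (by positivity) (by positivity)]
          refine ENNReal.ofReal_le_ofReal ?_
          nlinarith [mul_nonneg (sub_nonneg.2 hQ) (Nat.cast_nonneg (α := ℝ) q)]
  · have hb := expectedTime_bbht_le_of_pos hq ht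
    have hn := outcome_bbht_none_le ht
    rw [max_eq_left ht]
    set t := (solutions P).card
    have ht' : (1 : ℝ) ≤ t := by exact_mod_cast ht
    have hs : 1 ≤ √(t : ℝ) := Real.one_le_sqrt.2 ht'
    have hs2 := Real.mul_self_sqrt (Nat.cast_nonneg (α := ℝ) t)
    calc _ ≤ ENNReal.ofReal (16 * (3 * q + 5) * √(N / t)) +
          1 * (ENNReal.ofReal (16 * (3 * q + 5) * √(N / t))
          + ENNReal.ofReal (1 / (3 * t)) * ENNReal.ofReal ((19 * q + 37) * √(N * t₀))) := by
          gcongr; exact PMF.coe_le_one _ _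
      _ ≤ _ := by
          rw [one_mul, ← ENNReal.ofReal_mul (by positivity),
            ← ENNReal.ofReal_add (by positivity) (by positivity),
            ← ENNReal.ofReal_add (by positivity) (by positivity)]
          refine ENNReal.ofReal_le_ofReal ?_
          have h3 : √((N : ℝ) / t) ≤ √(N * t₀) / √t := by
            rw [Real.sqrt_div (Nat.cast_nonneg N)]; gcongr
          have h4 : 1 / (3 * (t : ℝ)) ≤ 1 / √t := by
            gcongr
            nlinarith
          have h5 : 1 / (3 * (t : ℝ)) * ((19 * q + 37) * √(N * t₀)) ≤
              (19 * q + 37) * (√(N * t₀) / √t) := by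
            calc _ ≤ 1 / √t * ((19 * q + 37) * √(N * t₀)) := by gcongr
              _ = _ := by ring
          have h6 : 16 * (3 * (q : ℝ) + 5) * √(N / t) ≤ 16 * (3 * q + 5) * (√(N * t₀) / √t) := by
            gcongr
          rw [mul_div_assoc]
          linarith

end Search
end QSP
namespace QSP

/-! ### Error and expected time of minimum finding, by rank -/

section Minfind

variable {N : ℕ}

/-- The predicate that *minfind* searches for: a smaller value than that of `y`. -/
noncomputable def smaller (F : Fin N → Timed (WithTop ℝ)) (y : Fin N) :
    Fin N → Timed Bool := fun x => do
  let u ← F x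
  Timed.op (decide (u < (F y).val))

/-- The number of elements with a smaller value than `y`. -/
noncomputable def valueRank (F : Fin N → Timed (WithTop ℝ)) (y : Fin N) : ℕ :=
  (solutions (smaller F y)).card

theorem mem_solutions_smaller {F : Fin N → Timed (WithTop ℝ)} {x y : Fin N} :
    x ∈ solutions (smaller F y) ↔ (F x).val < (F y).val := by
  rw [mem_solutions]
  show decide ((F x).val < (F y).val) = true ↔ _
  exact decide_eq_true_iff

theorem valueRank_lt {F : Fin N → Timed (WithTop ℝ)} {x y : Fin N}
    (h : x ∈ solutions (smaller F y)) : valueRank F x < valueRank F y := by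
  refine Finset.card_lt_card ⟨fun z hz => ?_, fun hsub => ?_⟩
  · rw [mem_solutions_smaller] at *
    exact hz.trans h
  · have := hsub h
    rw [mem_solutions_smaller] at this
    exact lt_irrefl _ this

theorem valueRank_eq_zero_iff {F : Fin N → Timed (WithTop ℝ)} {y : Fin N} :
    valueRank F y = 0 ↔ ∀ z, (F y).val ≤ (F z).val := by
  rw [valueRank, Finset.card_eq_zero, Finset.eq_empty_iff_forall_notMem]
  simp only [mem_solutions_smaller, not_lt]

/-- Sorted by value, the elements have ranks `0, 1, 2, …`, except that ties lower some of them.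
Inserting elements in increasing order leaves earlier ranks unchanged. -/
theorem sum_rank_le {ι : Type} [DecidableEq ι] (v : ι → WithTop ℝ) {g : ℕ → ℝ} (hg : Monotone g)
    (S : Finset ι) : ∑ y ∈ S, g (S.filter fun x => v x < v y).card ≤
      ∑ s ∈ Finset.range S.card, g s := by
  induction S using Finset.induction_on_max_value v with
  | empty => simp
  | insert a S ha hmax ih =>
    rw [Finset.sum_insert ha, Finset.card_insert_of_notMem ha, Finset.sum_range_succ, add_comm]
    refine add_le_add ?_ (hg ?_)
    · refine le_trans (le_of_eq (Finset.sum_congr rfl fun y hy => ?_)) ih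
      rw [Finset.filter_insert, if_neg (not_lt.2 (hmax y hy))]
    · rw [Finset.filter_insert, if_neg (lt_irrefl _)]
      exact Finset.card_filter_le _ _

theorem sum_valueRank_le (F : Fin N → Timed (WithTop ℝ)) (y : Fin N) {g : ℕ → ℝ}
    (hg : Monotone g) : ∑ x ∈ solutions (smaller F y), g (valueRank F x) ≤
      ∑ s ∈ Finset.range (valueRank F y), g s := by
  refine le_trans (le_of_eq (Finset.sum_congr rfl fun x hx => ?_))
    (sum_rank_le (fun x => (F x).val) hg _)
  rw [valueRank]
  congr 2
  ext z
  rw [Finset.mem_filter, mem_solutions_smaller, mem_solutions_smaller]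
  rw [mem_solutions_smaller] at hx
  exact ⟨fun h => ⟨h.trans hx, h⟩, fun h => h.2⟩

variable [NeZero N]

/-- Each round strictly lowers the rank, so the budget `r` suffices to reach rank `0`. At rank `t`
the round errs with probability at most `ε'/(9t²)`, which fits into the increment `ε'/(t(t+1))` of
the bound `ε' t/(t+1)` from `t - 1` to `t`. -/
theorem prob_minfindLoop_le (F : Fin N → Timed (WithTop ℝ)) {εinv : ℝ} (hε : 1 < εinv) (r : ℕ)
    (y : Fin N) (hr : valueRank F y ≤ r) :
    (minfindLoop F εinv r y).prob {x | ∀ z, (F x).val ≤ (F z).val}ᶜ ≤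
      ENNReal.ofReal (1 / εinv * (valueRank F y / (valueRank F y + 1))) := by
  have hε0 : 0 < εinv := by linarith
  induction r generalizing y with
  | zero =>
    rw [minfindLoop, QProg.prob_pure_le]
    · exact zero_le
    · rw [Set.mem_compl_iff, not_not]
      exact valueRank_eq_zero_iff.1 (Nat.le_zero.1 hr)
  | succ r ih =>
    rw [minfindLoop, QProg.prob_run_bind, QProg.prob_bind, QProg.tsum_option]
    change (findsol (smaller F y) εinv).outcome none * (pure y : QProg (Fin N)).prob _ +
      ∑' x, (findsol (smaller F y) εinv).outcome (some x) * (minfindLoop F εinv r x).prob _ ≤ _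
    have hU := findsUniformly_findsol (smaller F y) εinv
    rcases Nat.eq_zero_or_pos (valueRank F y) with ht | ht
    · have hy := valueRank_eq_zero_iff.1 ht
      rw [QProg.prob_pure_le (by rwa [Set.mem_compl_iff, not_not]), mul_zero, zero_add]
      refine le_trans (le_of_eq ?_) zero_le
      rw [ENNReal.tsum_eq_zero]
      intro x
      rw [hU.eq_zero x, zero_mul]
      rw [mem_solutions_smaller, not_lt]
      exact hy x
    · have hnone := outcome_findsol_none_le hε ht
      rw [← valueRank] at hnone
      set t := valueRank F y with htdef
      have ht' : (1 : ℝ) ≤ t := by exact_mod_cast ht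
      have hsome (x : Fin N) : (findsol (smaller F y) εinv).outcome (some x) *
          (minfindLoop F εinv r x).prob {x | ∀ z, (F x).val ≤ (F z).val}ᶜ ≤
          (findsol (smaller F y) εinv).outcome (some x) *
            ENNReal.ofReal (1 / εinv * ((t - 1) / t)) := by
        by_cases hx : x ∈ solutions (smaller F y)
        · gcongr
          have hlt := valueRank_lt hx
          refine (ih x (by omega)).trans (ENNReal.ofReal_le_ofReal ?_)
          have : (valueRank F x : ℝ) + 1 ≤ t := by exact_mod_cast hlt
          refine mul_le_mul_of_nonneg_left ?_ (by positivity)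
          rw [div_le_div_iff₀ (by positivity) (by positivity)]
          nlinarith
        · rw [hU.eq_zero x hx, zero_mul, zero_mul]
      calc _ ≤ ENNReal.ofReal (1 / (9 * (t : ℝ) ^ 2) * (1 / εinv)) * 1 +
            1 * ENNReal.ofReal (1 / εinv * ((t - 1) / t)) := by
            refine add_le_add (mul_le_mul' hnone (QProg.prob_le_one _ _))
              ((ENNReal.tsum_le_tsum hsome).trans ?_)
            rw [ENNReal.tsum_mul_right]
            gcongr
            rw [← (findsol (smaller F y) εinv).outcome.tsum_coe, QProg.tsum_option]
            exact le_add_left le_rfl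
        _ ≤ _ := by
            have hp : 0 ≤ 1 / εinv * (((t : ℝ) - 1) / t) := by
              have : (0 : ℝ) ≤ t - 1 := by linarith
              positivity
            rw [mul_one, one_mul, ← ENNReal.ofReal_add (by positivity) hp]
            refine ENNReal.ofReal_le_ofReal ?_
            rw [mul_comm (1 / (9 * (t : ℝ) ^ 2)), ← mul_add]
            gcongr
            have h1 : (t : ℝ) / (t + 1) = (t - 1) / t + 1 / (t * (t + 1)) := by
              field_simp; ring
            have h2 : 1 / (9 * (t : ℝ) ^ 2) ≤ 1 / (t * (t + 1)) := by
              exact one_div_le_one_div_of_le (by positivity) (by nlinarith)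
            linarith

/-- The potential that bounds the expected running time of *minfind* in terms of the rank. -/
noncomputable def minfindPotential (t : ℕ) : ℝ := 17 - 16 / √((t + 1 : ℕ) : ℝ)

theorem minfindPotential_mono : Monotone minfindPotential := by
  intro s t h
  unfold minfindPotential
  gcongr

theorem one_le_minfindPotential (t : ℕ) : 1 ≤ minfindPotential t := by
  have := minfindPotential_mono (Nat.zero_le t)
  refine le_trans ?_ this
  norm_num [minfindPotential]

theorem minfindPotential_le (t : ℕ) : minfindPotential t ≤ 17 :=
  sub_le_self _ (by positivity)

/-- The recurrence of the running time: a round at rank `t` costs `1/√t` units and continues at a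
rank that is on average no worse than uniform below `t`. The lower bound `2√(t+1) - 2` on the sum of
`1/√(s+1)` makes the potential satisfy it. -/
theorem minfindPotential_step {t : ℕ} (ht : 0 < t) :
    1 / √(t : ℝ) + 1 / t * ∑ s ∈ Finset.range t, minfindPotential s ≤ minfindPotential t := by
  have ht' : (1 : ℝ) ≤ t := by exact_mod_cast ht
  have hsum : ∑ s ∈ Finset.range t, minfindPotential s =
      17 * t - 16 * ∑ s ∈ Finset.range t, 1 / √((s + 1 : ℕ) : ℝ) := by
    unfold minfindPotential
    rw [Finset.sum_sub_distrib, Finset.sum_const, Finset.card_range, nsmul_eq_mul, mul_comm,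
      Finset.mul_sum]
    simp only [mul_one_div]
  have hlow := le_sum_one_div_sqrt t
  set u := √((t + 1 : ℕ) : ℝ) with hu
  set σ := ∑ s ∈ Finset.range t, 1 / √((s + 1 : ℕ) : ℝ)
  have hu2 : u * u = t + 1 := by
    rw [hu, Real.mul_self_sqrt (Nat.cast_nonneg _)]; push_cast; ring
  have hu0 : 0 < u := by positivity
  -- `4/3` is the larger root of `15u² - 32u + 16`, whose sign decides `h2` below; `u ≥ √2` exceeds
  -- it.
  have hu1 : 4 / 3 ≤ u := by nlinarith
  have hv : √(t : ℝ) ≤ u := Real.sqrt_le_sqrt (by push_cast; linarith)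
  have hv2 := Real.mul_self_sqrt (Nat.cast_nonneg (α := ℝ) t)
  have hv0 : 0 < √(t : ℝ) := by positivity
  rw [hsum, minfindPotential, ← hu]
  have e1 : 1 / √(t : ℝ) = √t / t := by
    rw [div_eq_div_iff hv0.ne' (by positivity), hv2, one_mul]
  have key : √(t : ℝ) + (17 * t - 16 * σ) ≤ (17 - 16 / u) * t := by
    have : 16 / u * t = 16 * u - 16 / u := by
      rw [show (t : ℝ) = u * u - 1 by linarith]; field_simp
    have h2 : 16 / u ≥ 32 - 15 * u := by
      rw [ge_iff_le, le_div_iff₀ hu0]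
      nlinarith
    rw [sub_mul, this]
    linarith
  rw [e1, one_div, ← div_eq_inv_mul, ← add_div, div_le_iff₀ (by linarith)]
  exact key

theorem expectedTime_minfindLoop_le {F : Fin N → Timed (WithTop ℝ)} {q : ℕ}
    (hq : ∀ x, (F x).time ≤ q) {εinv : ℝ} (hε : 1 < εinv) (r : ℕ) (y : Fin N) :
    (minfindLoop F εinv r y).expectedTime ≤
      ENNReal.ofReal ((116 * q + 312) * √(N * exactSearches N εinv) *
        minfindPotential (valueRank F y)) := by
  have h0 := exactSearches_pos (N := N) hε
  have hfs := fun y => expectedTime_findsol_le (P := smaller F y) (q := q + 1)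
    (fun x => Nat.add_le_add_right (hq x) 1) hε
  have hN1 : 1 ≤ N := NeZero.pos N
  set t₀ := exactSearches N εinv
  set Q := √((N : ℝ) * t₀) with hQ
  have hQN : √(N : ℝ) ≤ Q := Real.sqrt_le_sqrt
    (le_mul_of_one_le_right (Nat.cast_nonneg N) (by exact_mod_cast h0))
  have hround (y : Fin N) : ((F y).time : ℝ≥0∞) + (findsol (smaller F y) εinv).expectedTime ≤
      ENNReal.ofReal ((116 * q + 312) * Q * (1 / √((max (valueRank F y) 1 : ℕ) : ℝ))) := by
    refine (add_le_add (Nat.cast_le.2 (hq y)) (hfs y)).trans ?_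
    rw [← valueRank, ← ENNReal.ofReal_natCast, ← ENNReal.ofReal_add (by positivity) (by positivity)]
    refine ENNReal.ofReal_le_ofReal ?_
    set T := max (valueRank F y) 1 with hT
    have hTN : T ≤ N := max_le (card_solutions_le _) hN1
    have hT0 : (0 : ℝ) < T := by
      have : 1 ≤ T := le_max_right _ _
      exact_mod_cast this
    have h1 : 1 ≤ Q / √(T : ℝ) := by
      rw [le_div_iff₀ (by positivity), one_mul]
      exact le_trans (Real.sqrt_le_sqrt (by exact_mod_cast hTN)) hQN
    rw [mul_div_assoc, mul_one_div, mul_div_assoc]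
    push_cast
    nlinarith [mul_nonneg (sub_nonneg.2 h1) (Nat.cast_nonneg (α := ℝ) q)]
  induction r generalizing y with
  | zero => rw [minfindLoop, QProg.expectedTime_pure]; exact zero_le
  | succ r ih =>
    rw [minfindLoop, QProg.expectedTime_run_bind, QProg.expectedTime_bind, QProg.tsum_option]
    change (F y).time + ((findsol (smaller F y) εinv).expectedTime +
      ((findsol (smaller F y) εinv).outcome none * (pure y : QProg (Fin N)).expectedTime +
      ∑' x, (findsol (smaller F y) εinv).outcome (some x) *
        (minfindLoop F εinv r x).expectedTime)) ≤ _
    rw [QProg.expectedTime_pure, mul_zero, zero_add, ← add_assoc, tsum_fintype]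
    have hU := findsUniformly_findsol (smaller F y) εinv
    -- Only better elements are ever returned, so the recursion runs over them alone, each with
    -- weight at most `1/t`.
    rw [← Finset.sum_subset (Finset.subset_univ (solutions (smaller F y)))
      fun x _ hx => by rw [hU.eq_zero x hx, zero_mul]]
    rcases Nat.eq_zero_or_pos (valueRank F y) with ht | ht
    · have : solutions (smaller F y) = ∅ := Finset.card_eq_zero.1 ht
      rw [this, Finset.sum_empty, add_zero]
      refine (hround y).trans (ENNReal.ofReal_le_ofReal ?_)
      gcongr
      rw [ht, zero_max, Nat.cast_one, Real.sqrt_one, div_one]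
      exact one_le_minfindPotential 0
    · have ht' : (1 : ℝ) ≤ valueRank F y := by exact_mod_cast ht
      have hsome (x : Fin N) (hx : x ∈ solutions (smaller F y)) :
          (findsol (smaller F y) εinv).outcome (some x) * (minfindLoop F εinv r x).expectedTime ≤
          ENNReal.ofReal (1 / valueRank F y * ((116 * q + 312) * Q *
            minfindPotential (valueRank F x))) := by
        rw [ENNReal.ofReal_mul (by positivity)]
        refine mul_le_mul' ?_ (ih x)
        have := hU.card_mul_outcome_le hx
        rw [← valueRank, mul_comm, ← ENNReal.le_div_iff_mul_le
          (Or.inl (by simpa using ht.ne')) (Or.inl (ENNReal.natCast_ne_top _))] at this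
        rwa [one_div, ENNReal.ofReal_inv_of_pos (by linarith), ENNReal.ofReal_natCast, ← one_div]
      refine (add_le_add (hround y) (Finset.sum_le_sum hsome)).trans ?_
      have hpot (x : Fin N) : 0 ≤ minfindPotential (valueRank F x) :=
        zero_le_one.trans (one_le_minfindPotential _)
      rw [← ENNReal.ofReal_sum_of_nonneg fun x _ => by have := hpot x; positivity,
        ← ENNReal.ofReal_add (by positivity)
          (Finset.sum_nonneg fun x _ => by have := hpot x; positivity),
        ← Finset.mul_sum, ← Finset.mul_sum, max_eq_left ht]
      refine ENNReal.ofReal_le_ofReal ?_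
      calc _ = (116 * q + 312) * Q * (1 / √(valueRank F y : ℝ) + 1 / valueRank F y *
            ∑ x ∈ solutions (smaller F y), minfindPotential (valueRank F x)) := by ring
        _ ≤ (116 * q + 312) * Q * (1 / √(valueRank F y : ℝ) + 1 / valueRank F y *
            ∑ s ∈ Finset.range (valueRank F y), minfindPotential s) := by
            gcongr
            exact sum_valueRank_le F y minfindPotential_mono
        _ ≤ _ := by
            gcongr
            exact minfindPotential_step ht

/-- *minfind* fails with probability at most `1 / εinv`. -/
theorem prob_minfind_le (F : Fin N → Timed (WithTop ℝ)) {εinv : ℝ} (hε : 1 < εinv) :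
    (minfind F εinv).prob {x | ∀ z, (F x).val ≤ (F z).val}ᶜ ≤ ENNReal.ofReal (1 / εinv) := by
  rw [minfind, QProg.prob_bind]
  refine QProg.tsum_outcome_mul_le _ fun y => ?_
  refine (prob_minfindLoop_le F hε N y (card_solutions_le _)).trans (ENNReal.ofReal_le_ofReal ?_)
  refine mul_le_of_le_one_right (by positivity) ?_
  exact (div_le_one (by positivity)).2 (by linarith)

/-- The expected running time of *minfind* is `O(√(N t₀))`. -/
theorem expectedTime_minfind_le {F : Fin N → Timed (WithTop ℝ)} {q : ℕ}
    (hq : ∀ x, (F x).time ≤ q) {εinv : ℝ} (hε : 1 < εinv) :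
    (minfind F εinv).expectedTime ≤
      1 + ENNReal.ofReal (17 * (116 * q + 312) * √(N * exactSearches N εinv)) := by
  refine QProg.expectedTime_bind_le (QProg.expectedTime_uniform _).le fun y => ?_
  refine (expectedTime_minfindLoop_le hq hε N y).trans (ENNReal.ofReal_le_ofReal ?_)
  rw [mul_assoc 17, mul_comm 17]
  gcongr
  exact minfindPotential_le _

end Minfind
end QSP
namespace QSP

/-! ### Walks with a given number of edges -/

namespace WGraph

variable {n : ℕ}

/-- `G.HasWalk u k v ℓ`: some walk of `k` edges from `u` to `v` has total length `ℓ`. -/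
inductive HasWalk (G : WGraph n) (u : Fin n) : ℕ → Fin n → ℝ → Prop
  | nil : HasWalk G u 0 u 0
  | snoc {k : ℕ} {v w : Fin n} {ℓ x : ℝ} :
      HasWalk G u k v ℓ → G.weight v w = some x → HasWalk G u (k + 1) w (ℓ + x)

variable {G : WGraph n} {u v w : Fin n} {k m : ℕ} {ℓ ℓ' : ℝ}

theorem HasPath.exists_hasWalk (h : G.HasPath u v ℓ) : ∃ k, G.HasWalk u k v ℓ := by
  induction h with
  | nil => exact ⟨0, .nil⟩
  | snoc _ hx ih => obtain ⟨k, hk⟩ := ih; exact ⟨k + 1, hk.snoc hx⟩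

theorem HasWalk.hasPath (h : G.HasWalk u k v ℓ) : G.HasPath u v ℓ := by
  induction h with
  | nil => exact .nil
  | snoc _ hx ih => exact ih.snoc hx

theorem HasWalk.trans (h : G.HasWalk u k v ℓ) (h' : G.HasWalk v m w ℓ') :
    G.HasWalk u (k + m) w (ℓ + ℓ') := by
  induction h' with
  | nil => simpa using h
  | snoc _ hx ih => rw [← add_assoc, ← add_assoc]; exact ih.snoc hx

/-- The vertices of a walk, and the lengths of its initial segments. -/
theorem HasWalk.exists_trace (h : G.HasWalk u k v ℓ) : ∃ (p : ℕ → Fin n) (s : ℕ → ℝ),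
    p 0 = u ∧ p k = v ∧ s 0 = 0 ∧ s k = ℓ ∧
      ∀ i < k, ∃ x, G.weight (p i) (p (i + 1)) = some x ∧ s (i + 1) = s i + x := by
  induction h with
  | nil => exact ⟨fun _ => u, fun _ => 0, rfl, rfl, rfl, rfl, fun i hi => absurd hi (by omega)⟩
  | @snoc k v w ℓ x h hx ih =>
    obtain ⟨p, s, hp0, hpk, hs0, hsk, hps⟩ := ih
    refine ⟨Function.update p (k + 1) w, Function.update s (k + 1) (ℓ + x), ?_, ?_, ?_, ?_, ?_⟩
    · rw [Function.update_of_ne (by omega), hp0]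
    · rw [Function.update_self]
    · rw [Function.update_of_ne (by omega), hs0]
    · rw [Function.update_self]
    · intro i hi
      rw [Function.update_of_ne (by omega : i ≠ k + 1), Function.update_of_ne (by omega : i ≠ k + 1)]
      rcases (Nat.lt_succ_iff.1 hi).eq_or_lt with rfl | hi
      · rw [Function.update_self, Function.update_self, hpk, hsk]
        exact ⟨x, hx, rfl⟩
      · rw [Function.update_of_ne (by omega), Function.update_of_ne (by omega)]
        exact hps i hi

theorem hasWalk_of_trace {p : ℕ → Fin n} {s : ℕ → ℝ}
    (hps : ∀ i < k, ∃ x, G.weight (p i) (p (i + 1)) = some x ∧ s (i + 1) = s i + x) (i d : ℕ)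
    (h : i + d ≤ k) : G.HasWalk (p i) d (p (i + d)) (s (i + d) - s i) := by
  induction d with
  | zero => simpa using HasWalk.nil
  | succ d ih =>
    obtain ⟨x, hx, hs⟩ := hps (i + d) (by omega)
    rw [← add_assoc, hs, add_sub_right_comm]
    exact (ih (by omega)).snoc hx

/-- A walk with at least `n` edges repeats a vertex. The closed part in between is reachable from
`a`, hence not negative, and can be cut out. -/
theorem exists_shorter_walk {a : Fin n} (hG : ¬ G.NegCycleReachable a) (h : G.HasWalk a k v ℓ)
    (hk : n ≤ k) : ∃ k' < k, ∃ ℓ' ≤ ℓ, G.HasWalk a k' v ℓ' := by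
  obtain ⟨p, s, hp0, hpk, hs0, hsk, hps⟩ := h.exists_trace
  obtain ⟨i, j, hij, hpij⟩ := Fintype.exists_ne_map_eq_of_card_lt
    (fun i : Fin (k + 1) => p i) (by simpa using Nat.lt_succ_of_le hk)
  wlog hlt : i < j generalizing i j
  · exact this j i hij.symm hpij.symm (lt_of_le_of_ne (not_lt.1 hlt) hij.symm)
  obtain ⟨d, hd⟩ := Nat.exists_eq_add_of_lt (Fin.lt_def.1 hlt)
  have hj : (j : ℕ) ≤ k := Nat.le_of_lt_succ j.2
  have h1 := hasWalk_of_trace hps 0 i (by omega)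
  have h2 := hasWalk_of_trace hps i (d + 1) (by omega)
  have h3 := hasWalk_of_trace hps j (k - j) (by omega)
  rw [zero_add, hp0, hs0, sub_zero] at h1
  rw [← add_assoc, ← hd, ← hpij] at h2
  rw [Nat.add_sub_cancel' hj, hpk, hsk, ← hpij] at h3
  have h4 : 0 ≤ s j - s i := by
    by_contra hneg
    exact hG ⟨p i, ⟨_, h1.hasPath⟩, _, not_le.1 hneg, h2.hasPath⟩
  exact ⟨i + (k - j), by omega, s i + (ℓ - s j), by linarith, h1.trans h3⟩

/-- Without reachable negative cycles, walks of fewer than `n` edges suffice. -/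
theorem exists_short_walk {a : Fin n} (hG : ¬ G.NegCycleReachable a) (h : G.HasWalk a k v ℓ) :
    ∃ k' ≤ n - 1, ∃ ℓ' ≤ ℓ, G.HasWalk a k' v ℓ' := by
  induction k using Nat.strong_induction_on generalizing ℓ with
  | _ k ih =>
    rcases le_or_gt k (n - 1) with hk | hk
    · exact ⟨k, hk, ℓ, le_rfl, h⟩
    · obtain ⟨k', hk', ℓ', hℓ', h'⟩ := exists_shorter_walk hG h (by omega)
      obtain ⟨m, hm, x, hx, hw⟩ := ih k' hk' h'
      exact ⟨m, hm, x, hx.trans hℓ', hw⟩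

end WGraph

/-! ### Relaxation -/

section BellmanFord

open QProg

variable {n : ℕ}

/-- `S'` results from a correct relaxation of the vertex `i` in `S`. -/
def RelaxStep (G : WGraph n) (i : Fin n) (S S' : SPState n) : Prop :=
  (S' = S ∧ ∀ j ℓ, G.weight j i = some ℓ → S.dist i ≤ S.dist j + (ℓ : WithTop ℝ)) ∨
  (S'.changed = true ∧ ∃ j ℓ, G.weight j i = some ℓ ∧ S.dist j + (ℓ : WithTop ℝ) < S.dist i ∧
    (∀ j' ℓ', G.weight j' i = some ℓ' → S.dist j + (ℓ : WithTop ℝ) ≤ S.dist j' + (ℓ' : WithTop ℝ)) ∧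
    S'.dist = Function.update S.dist i (S.dist j + (ℓ : WithTop ℝ)))

theorem prob_relax_le {N : ℕ} [NeZero N] {G : WGraph n} {i : Fin n}
    {cand : Fin N → Timed (Fin n × WithTop ℝ)} {εinv : ℝ} (hε : 1 < εinv)
    (hcand : ∀ j (ℓ : ℝ), G.weight j i = some ℓ ↔ ∃ x, (cand x).val = (j, (ℓ : WithTop ℝ)))
    (S : SPState n) :
    (relax cand εinv i S).prob {S' | RelaxStep G i S S'}ᶜ ≤ ENNReal.ofReal (1 / εinv) := by
  -- The summand `0` is for everything after `minfind`, which is deterministic.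
  rw [← add_zero (ENNReal.ofReal (1 / εinv)), relax]
  refine prob_compl_bind_le (prob_minfind_le _ hε) fun x hx => le_of_eq ?_
  rw [prob_run_bind, prob_run_bind, prob_run_bind, prob_run_bind]
  have hmin (j : Fin n) (ℓ : ℝ) (h : G.weight j i = some ℓ) :
      S.dist (cand x).val.1 + (cand x).val.2 ≤ S.dist j + (ℓ : WithTop ℝ) := by
    obtain ⟨z, hz⟩ := (hcand j ℓ).1 h
    have : S.dist (cand x).val.1 + (cand x).val.2 ≤ S.dist (cand z).val.1 + (cand z).val.2 := hx z
    rwa [hz] at this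
  change QProg.prob (if decide (S.dist (cand x).val.1 + (cand x).val.2 < S.dist i) = true then _
    else _) _ = 0
  split_ifs with hlt
  · rw [decide_eq_true_iff] at hlt
    rw [prob_run_bind]
    refine prob_pure_le ?_
    rw [Set.mem_compl_iff, not_not]
    right
    refine ⟨rfl, ?_⟩
    -- A value below `S.dist i` is finite, so the candidate found is an actual edge.
    obtain ⟨ℓ, hℓ⟩ := WithTop.ne_top_iff_exists.1 (WithTop.add_ne_top.1 hlt.ne_top).2
    rw [← hℓ] at hmin hlt
    refine ⟨(cand x).val.1, ℓ, (hcand _ _).2 ⟨x, by rw [hℓ]⟩, hlt, hmin, ?_⟩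
    rw [hℓ]
    rfl
  · rw [decide_eq_true_iff, not_lt] at hlt
    refine prob_pure_le ?_
    rw [Set.mem_compl_iff, not_not]
    exact Or.inl ⟨rfl, fun j ℓ h => hlt.trans (hmin j ℓ h)⟩

theorem expectedTime_relax_le {N : ℕ} [NeZero N] {cand : Fin N → Timed (Fin n × WithTop ℝ)}
    (hcand : ∀ x, (cand x).time ≤ 2) {εinv : ℝ} (hε : 1 < εinv) (i : Fin n) (S : SPState n) :
    (relax cand εinv i S).expectedTime ≤
      ENNReal.ofReal (13221 * √(N * exactSearches N εinv)) := by
  have h1 : 1 ≤ √((N : ℝ) * exactSearches N εinv) := by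
    refine Real.one_le_sqrt.2 ?_
    exact_mod_cast Nat.mul_pos (NeZero.pos N) (exactSearches_pos (N := N) hε)
  set Q := √((N : ℝ) * exactSearches N εinv)
  have hrest : (relax cand εinv i S).expectedTime ≤
      1 + ENNReal.ofReal (17 * (116 * (4 : ℕ) + 312) * Q) + ((11 : ℕ) : ℝ≥0∞) := by
    rw [relax]
    refine expectedTime_bind_le (expectedTime_minfind_le (q := 4)
      (fun x => Nat.add_le_add_right (hcand x) 2) hε) fun x => ?_
    rw [expectedTime_run_bind, expectedTime_run_bind, expectedTime_run_bind, expectedTime_run_bind]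
    have e1 : ((cand x).time : ℝ≥0∞) ≤ (2 : ℕ) := Nat.cast_le.2 (hcand x)
    have e2 : (((do
        let e ← cand x
        let d ← Timed.op (S.dist e.1)
        Timed.op (d + e.2)) : Timed (WithTop ℝ)).time : ℝ≥0∞) ≤ (4 : ℕ) :=
      Nat.cast_le.2 (Nat.add_le_add_right (hcand x) 2)
    have e3 (c : Bool) (S₁ S₂ : SPState n) :
        (if c = true then do QProg.run (Timed.ticks 3); pure S₁
          else pure S₂ : QProg (SPState n)).expectedTime ≤ (3 : ℕ) := by
      split_ifs
      · rw [expectedTime_run_bind, expectedTime_pure, add_zero]; exact le_rfl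
      · rw [expectedTime_pure]; exact zero_le
    refine (add_le_add e1 (add_le_add e2 (add_le_add (le_refl ((1 : ℕ) : ℝ≥0∞))
      (add_le_add (le_refl ((1 : ℕ) : ℝ≥0∞)) (e3 _ _ _))))).trans_eq ?_
    norm_num
  refine hrest.trans ?_
  rw [← ENNReal.ofReal_natCast, ← ENNReal.ofReal_one, ← ENNReal.ofReal_add (by positivity)
    (by positivity), ← ENNReal.ofReal_add (by positivity) (by positivity)]
  refine ENNReal.ofReal_le_ofReal ?_
  push_cast
  linarith

/-! ### Correctness of the Bellman–Ford algorithm -/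

section Relations

variable {G : WGraph n} {a i : Fin n} {L : List (Fin n)} {S S' : SPState n}

/-- Finite entries of `dist` are lengths of paths. -/
def SPState.Sound (G : WGraph n) (a : Fin n) (S : SPState n) : Prop :=
  ∀ v (d : ℝ), S.dist v = d → G.HasPath a v d

theorem RelaxStep.dist_le (h : RelaxStep G i S S') (v : Fin n) : S'.dist v ≤ S.dist v := by
  rcases h with ⟨rfl, -⟩ | ⟨-, j, ℓ, -, hlt, -, hS'⟩
  · exact le_rfl
  · rw [hS', Function.update_apply]
    split_ifs with hv
    · rw [hv]; exact hlt.le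
    · exact le_rfl

theorem RelaxStep.dist_le_add (h : RelaxStep G i S S') {j : Fin n} {ℓ : ℝ}
    (hw : G.weight j i = some ℓ) : S'.dist i ≤ S.dist j + (ℓ : WithTop ℝ) := by
  rcases h with ⟨rfl, h⟩ | ⟨-, j', ℓ', -, -, hmin, hS'⟩
  · exact h j ℓ hw
  · rw [hS', Function.update_self]
    exact hmin j ℓ hw

theorem RelaxStep.sound (h : RelaxStep G i S S') (hS : S.Sound G a) : S'.Sound G a := by
  rcases h with ⟨rfl, -⟩ | ⟨-, j, ℓ, hw, -, -, hS'⟩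
  · exact hS
  · intro v d hd
    rw [hS', Function.update_apply] at hd
    split_ifs at hd with hv
    · obtain ⟨x, y, hx, hy, hxy⟩ := WithTop.add_eq_coe.1 hd
      rw [← hxy, hv]
      obtain rfl : ℓ = y := WithTop.coe_injective hy.symm
      exact (hS j x hx.symm).snoc hw
    · exact hS v d hd

theorem RelaxStep.changed (h : RelaxStep G i S S') (hS : S.changed = true) :
    S'.changed = true := by
  rcases h with ⟨rfl, -⟩ | ⟨h, -⟩
  · exact hS
  · exact h

theorem FoldRel.dist_le (h : FoldRel (RelaxStep G) L S S') (v : Fin n) :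
    S'.dist v ≤ S.dist v := by
  induction h with
  | nil => exact le_rfl
  | cons h _ ih => exact ih.trans (h.dist_le v)

theorem FoldRel.sound (h : FoldRel (RelaxStep G) L S S') (hS : S.Sound G a) : S'.Sound G a := by
  induction h with
  | nil => exact hS
  | cons h _ ih => exact ih (h.sound hS)

theorem FoldRel.changed (h : FoldRel (RelaxStep G) L S S') (hS : S.changed = true) :
    S'.changed = true := by
  induction h with
  | nil => exact hS
  | cons h _ ih => exact ih (h.changed hS)

theorem FoldRel.dist_le_add (h : FoldRel (RelaxStep G) L S S') (hi : i ∈ L) {j : Fin n} {ℓ : ℝ}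
    (hw : G.weight j i = some ℓ) : S'.dist i ≤ S.dist j + (ℓ : WithTop ℝ) := by
  induction h with
  | nil => simp at hi
  | cons h h' ih =>
    rcases List.mem_cons.1 hi with rfl | hi
    · exact (FoldRel.dist_le h' i).trans (h.dist_le_add hw)
    -- Relaxations earlier in the same pass may already have lowered the entry at `j`; this only
    -- strengthens the bound.
    · exact (ih hi).trans (by gcongr; exact h.dist_le j)

theorem FoldRel.eq_of_not_changed (h : FoldRel (RelaxStep G) L S S')
    (hS : S'.changed ≠ true) : S' = S := by
  induction h with
  | nil => rfl
  | cons h h' ih =>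
    have e := ih hS
    rcases h with ⟨rfl, -⟩ | ⟨h, -⟩
    · exact e
    · exact absurd (FoldRel.changed h' h) hS

/-- An improving relaxation would, by soundness, exhibit a path shorter than an entry that no path
can beat. -/
theorem FoldRel.eq_of_optimal (h : FoldRel (RelaxStep G) L S S') (hS : S.Sound G a)
    (hopt : ∀ v ℓ, G.HasPath a v ℓ → S.dist v ≤ (ℓ : WithTop ℝ)) : S' = S := by
  induction h with
  | nil => rfl
  | cons h h' ih =>
    rcases h with ⟨rfl, -⟩ | ⟨-, j, ℓ, hw, hlt, -, -⟩
    · exact ih hS hopt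
    · obtain ⟨d, hd⟩ := WithTop.ne_top_iff_exists.1 (WithTop.add_ne_top.1 hlt.ne_top).1
      rw [← hd, ← WithTop.coe_add] at hlt
      exact absurd (hopt _ _ ((hS j d hd.symm).snoc hw)) (not_le.2 hlt)

/-- After `k` passes, `dist` is at most the length of each walk of at most `k` edges. -/
theorem FoldRel.passes {κ : Type} {K : List κ}
    (hL : ∀ i j ℓ, G.weight j i = some ℓ → i ∈ L) (hS : S.Sound G a)
    (h : FoldRel (fun _ S S' => FoldRel (RelaxStep G) L S S') K S S') :
    S'.Sound G a ∧ (∀ v, S'.dist v ≤ S.dist v) ∧ ∀ k₀,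
      (∀ k ≤ k₀, ∀ v ℓ, G.HasWalk a k v ℓ → S.dist v ≤ (ℓ : WithTop ℝ)) →
      ∀ k ≤ k₀ + K.length, ∀ v ℓ, G.HasWalk a k v ℓ → S'.dist v ≤ (ℓ : WithTop ℝ) := by
  induction h with
  | nil => exact ⟨hS, fun _ => le_rfl, fun k₀ h => h⟩
  | cons h _ ih =>
    obtain ⟨h1, h2, h3⟩ := ih (FoldRel.sound h hS)
    refine ⟨h1, fun v => (h2 v).trans (FoldRel.dist_le h v), fun k₀ hk₀ k hk => ?_⟩
    refine h3 (k₀ + 1) (fun k hk v ℓ hw => ?_) k (by rw [List.length_cons] at hk; omega)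
    cases hw with
    | nil => exact (FoldRel.dist_le h _).trans (hk₀ 0 (Nat.zero_le _) _ _ .nil)
    | @snoc k u v ℓ x hw hx =>
      refine (FoldRel.dist_le_add h (hL _ _ _ hx) hx).trans ?_
      rw [WithTop.coe_add]
      gcongr
      exact hk₀ k (by omega) _ _ hw

/-- If the last pass changes something although no negative cycle is reachable, `n - 1` passes have
already covered all shortest walks, a contradiction. If it changes nothing, `dist` satisfies the
triangle inequality along every edge, which alone excludes reachable negative cycles and, with
soundness, makes every entry optimal. -/
theorem correct_of_passes (hL : ∀ i j ℓ, G.weight j i = some ℓ → i ∈ L)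
    (h : FoldRel (fun _ S S' => FoldRel (RelaxStep G) L S S') (List.range (n - 1))
      (initState a).val S)
    (h' : FoldRel (RelaxStep G) L { S with changed := false } S') :
    G.Correct a (if S'.changed = true then none else some S'.dist) := by
  have hinit : (initState a).val.dist = Function.update (fun _ => ⊤) a 0 := rfl
  have hS0 : (initState a).val.Sound G a := by
    intro v d hd
    rw [hinit, Function.update_apply] at hd
    split_ifs at hd with hv
    · obtain rfl : (0 : ℝ) = d := WithTop.coe_injective hd
      rw [hv]; exact .nil
    · exact absurd hd WithTop.top_ne_coe
  have h0 : (initState a).val.dist a = 0 := by rw [hinit, Function.update_self]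
  obtain ⟨h1, h2, h3⟩ := FoldRel.passes hL hS0 h
  have hS : SPState.Sound G a { S with changed := false } := h1
  split_ifs with hc
  · show G.NegCycleReachable a
    by_contra hG
    have hopt (v : Fin n) (ℓ : ℝ) (hp : G.HasPath a v ℓ) : S.dist v ≤ (ℓ : WithTop ℝ) := by
      obtain ⟨k, hk⟩ := hp.exists_hasWalk
      obtain ⟨k', hk', ℓ', hℓ', hw⟩ := WGraph.exists_short_walk hG hk
      refine le_trans (h3 0 ?_ k' (by simpa using hk') v ℓ' hw) (WithTop.coe_le_coe.2 hℓ')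
      intro k hk v ℓ hw
      obtain rfl : k = 0 := by omega
      cases hw
      rw [h0]; exact le_rfl
    rw [FoldRel.eq_of_optimal h' hS hopt] at hc
    exact absurd hc (by simp)
  · have heq := FoldRel.eq_of_not_changed h' hc
    have hd : S'.dist = S.dist := by rw [heq]
    -- The edge inequalities add up along paths. For a closed path with finite `dist` they say that
    -- its length is nonnegative.
    have hrel (u v : Fin n) (ℓ : ℝ) (hp : G.HasPath u v ℓ) :
        S.dist v ≤ S.dist u + (ℓ : WithTop ℝ) := by
      induction hp with
      | nil => exact le_of_eq (add_zero _).symm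
      | snoc _ hx ih =>
        have := FoldRel.dist_le_add h' (hL _ _ _ hx) hx
        rw [hd] at this
        rw [WithTop.coe_add, ← add_assoc]
        exact this.trans (by gcongr)
    have hopt (v : Fin n) (ℓ : ℝ) (hp : G.HasPath a v ℓ) : S.dist v ≤ (ℓ : WithTop ℝ) := by
      refine (hrel a v ℓ hp).trans ?_
      calc S.dist a + (ℓ : WithTop ℝ) ≤ 0 + (ℓ : WithTop ℝ) := by
            gcongr
            rw [← h0]; exact h2 a
        _ = ℓ := zero_add _
    rw [hd]
    refine ⟨?_, fun v => ?_⟩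
    · rintro ⟨v, ⟨ℓ, hp⟩, c, hc, hcyc⟩
      obtain ⟨d, hd⟩ := WithTop.ne_top_iff_exists.1 ((hopt v ℓ hp).trans_lt (WithTop.coe_lt_top ℓ)).ne
      have := hrel v v c hcyc
      rw [← hd, ← WithTop.coe_add, WithTop.coe_le_coe] at this
      linarith
    · cases hv : S.dist v with
      | top =>
        intro ℓ hp
        have := hopt v ℓ hp
        rw [hv] at this
        exact absurd this (not_le.2 (WithTop.coe_lt_top ℓ))
      | coe d =>
        refine ⟨h1 v d hv, fun ℓ hp => ?_⟩
        have := hopt v ℓ hp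
        rwa [hv, WithTop.coe_le_coe] at this

end Relations

/-! ### Error and expected time of Bellman–Ford with randomized relaxations -/

variable {relaxAt : Fin n → SPState n → QProg (SPState n)} {L : List (Fin n)}

theorem prob_pass_le {R : Fin n → SPState n → SPState n → Prop} {δ : ℝ≥0∞}
    (h : ∀ S, ∀ i ∈ L, (relaxAt i S).prob {S' | R i S S'}ᶜ ≤ δ) (S : SPState n) :
    (pass relaxAt L S).prob {S' | FoldRel R L S S'}ᶜ ≤ L.length * δ :=
  prob_foldlM_compl_le _ R δ L (fun S i hi => by rw [prob_run_bind]; exact h S i hi) S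

theorem prob_bellmanFord_le {G : WGraph n} (a : Fin n)
    (hL : ∀ i j ℓ, G.weight j i = some ℓ → i ∈ L) {δ : ℝ≥0∞}
    (h : ∀ S, ∀ i ∈ L, (relaxAt i S).prob {S' | RelaxStep G i S S'}ᶜ ≤ δ) :
    (bellmanFord relaxAt L a).prob {r | G.Correct a r}ᶜ ≤ n * (L.length * δ) := by
  have hn : n = (n - 1) + 1 := by have := a.pos; omega
  -- The `n` passes split into the main loop and the checking pass; the last `0` is for reading the
  -- flag.
  have e : (n : ℝ≥0∞) * (L.length * δ) = ((n - 1 : ℕ) : ℝ≥0∞) * (L.length * δ) +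
      (L.length * δ + 0) := by
    nth_rw 1 [hn]
    push_cast
    ring
  rw [e, bellmanFord, prob_run_bind]
  have h1 := prob_foldlM_compl_le (fun S (_ : ℕ) => do QProg.run (Timed.ticks 1); pass relaxAt L S)
    (fun _ S S' => FoldRel (RelaxStep G) L S S') (L.length * δ) (List.range (n - 1))
    (fun S _ _ => by rw [prob_run_bind]; exact prob_pass_le h S) (initState a).val
  rw [List.length_range] at h1
  refine prob_compl_bind_le h1 fun S hS => ?_
  rw [prob_run_bind]
  refine prob_compl_bind_le (prob_pass_le h _) fun S' hS' => le_of_eq ?_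
  rw [prob_run_bind]
  have hc := correct_of_passes hL hS hS'
  change QProg.prob (if S'.changed = true then _ else _) _ = 0
  split_ifs at hc ⊢ with hch
  · exact prob_pure_le (by rwa [Set.mem_compl_iff, not_not])
  · exact prob_pure_le (by rwa [Set.mem_compl_iff, not_not])

theorem expectedTime_pass_le {b : Fin n → ℝ≥0∞}
    (h : ∀ S, ∀ i ∈ L, (relaxAt i S).expectedTime ≤ b i) (S : SPState n) :
    (pass relaxAt L S).expectedTime ≤ (L.map fun i => 1 + b i).sum := by
  refine expectedTime_foldlM_le _ _ L (fun S i hi => ?_) S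
  rw [expectedTime_run_bind]
  exact add_le_add Nat.cast_one.le (h S i hi)

theorem expectedTime_bellmanFord_le (a : Fin n) {b : Fin n → ℝ≥0∞}
    (h : ∀ S, ∀ i ∈ L, (relaxAt i S).expectedTime ≤ b i) :
    (bellmanFord relaxAt L a).expectedTime ≤
      ((2 * n + 2 : ℕ) : ℝ≥0∞) + n * (1 + (L.map fun i => 1 + b i).sum) := by
  have hn : n = (n - 1) + 1 := by have := a.pos; omega
  set B := (L.map fun i => 1 + b i).sum
  have e : ((2 * n + 2 : ℕ) : ℝ≥0∞) + n * (1 + B) =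
      ((2 * n + 1 : ℕ) : ℝ≥0∞) + (((n - 1 : ℕ) : ℝ≥0∞) * (1 + B) + (1 + (B + (1 + 0)))) := by
    have : (n : ℝ≥0∞) = ((n - 1 : ℕ) : ℝ≥0∞) + 1 := by nth_rw 1 [hn]; push_cast; rfl
    generalize ((n - 1 : ℕ) : ℝ≥0∞) = m at this ⊢
    push_cast
    rw [this]
    ring
  rw [e, bellmanFord, expectedTime_run_bind]
  refine add_le_add le_rfl (expectedTime_bind_le ?_ fun S => ?_)
  · refine (expectedTime_foldlM_le _ (fun _ => 1 + B) _ (fun S _ _ => ?_) _).trans ?_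
    · rw [expectedTime_run_bind]
      exact add_le_add Nat.cast_one.le (expectedTime_pass_le h S)
    · rw [List.map_const', List.sum_replicate, List.length_range, nsmul_eq_mul]
  · rw [expectedTime_run_bind]
    refine add_le_add Nat.cast_one.le (expectedTime_bind_le (expectedTime_pass_le h _) fun S' => ?_)
    rw [expectedTime_run_bind]
    refine add_le_add Nat.cast_one.le (le_of_eq ?_)
    split_ifs <;> exact expectedTime_pure _

end BellmanFord
end QSP
namespace QSP

/-! ### The array of incoming edges -/

section Incoming

variable {n : ℕ}

theorem Timed.foldlM_val {α σ : Type} (f : σ → α → Timed σ) (L : List α) (s : σ) :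
    (L.foldlM f s).val = L.foldl (fun s a => (f s a).val) s := by
  induction L generalizing s with
  | nil => rfl
  | cons a L ih => rw [List.foldlM_cons, List.foldl_cons]; exact ih _

theorem Timed.foldlM_time {α σ : Type} (f : σ → α → Timed σ) (T : α → ℕ)
    (hT : ∀ s a, (f s a).time = T a) (L : List α) (s : σ) :
    (L.foldlM f s).time = (L.map T).sum := by
  induction L generalizing s with
  | nil => rfl
  | cons a L ih =>
    rw [List.foldlM_cons, List.map_cons, List.sum_cons, ← ih (f s a).val, ← hT s a]
    rfl

variable (deg : Fin n → ℕ) (edge : (i : Fin n) → Fin (deg i) → Fin n × ℝ)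

/-- Append one edge outgoing from `i` to the array of incoming edges. -/
def appendEdge (i : Fin n) (f : Fin n → List (Fin n × ℝ)) (k : Fin (deg i)) :
    Fin n → List (Fin n × ℝ) :=
  Function.update f (edge i k).1 (f (edge i k).1 ++ [(i, (edge i k).2)])

theorem incoming_val : (incoming deg edge).val = (List.finRange n).foldl
    (fun f i => (List.finRange (deg i)).foldl (appendEdge deg edge i) f) (fun _ => []) := by
  refine (Timed.foldlM_val _ _ _).trans ?_
  congr 1
  funext f i
  exact Timed.foldlM_val _ _ _

theorem incoming_time : (incoming deg edge).time = 2 * n + 2 * ∑ i, deg i := by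
  have h : (incoming deg edge).time = n + ((List.finRange n).map fun i => 1 + 2 * deg i).sum := by
    refine congrArg (n + ·) ?_
    refine Timed.foldlM_time _ (fun i => 1 + 2 * deg i) (fun f i => congrArg (1 + ·) ?_) _ _
    refine (Timed.foldlM_time _ (fun _ => 2) (fun f k => rfl) _ _).trans ?_
    rw [List.map_const', List.sum_replicate, List.length_finRange, smul_eq_mul, mul_comm]
  rw [h, ← List.ofFn_eq_map, List.sum_ofFn, Finset.sum_add_distrib, ← Finset.mul_sum]
  simp
  ring

theorem mem_foldl_appendEdge (i : Fin n) (K : List (Fin (deg i)))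
    (f : Fin n → List (Fin n × ℝ)) (v : Fin n) (p : Fin n × ℝ) :
    p ∈ K.foldl (appendEdge deg edge i) f v ↔
      p ∈ f v ∨ (p.1 = i ∧ ∃ k ∈ K, edge i k = (v, p.2)) := by
  induction K generalizing f with
  | nil => simp
  | cons k K ih =>
    rw [List.foldl_cons, ih, appendEdge, Function.update_apply]
    have : p ∈ (if v = (edge i k).1 then f (edge i k).1 ++ [(i, (edge i k).2)] else f v) ↔
        p ∈ f v ∨ (p.1 = i ∧ edge i k = (v, p.2)) := by
      split_ifs with h
      · rw [List.mem_append, List.mem_singleton, ← h, Prod.ext_iff, Prod.ext_iff (x := edge i k)]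
        simp only [← h, true_and, eq_comm]
      · constructor
        · exact Or.inl
        · rintro (h' | ⟨-, h'⟩)
          · exact h'
          · exact absurd (by rw [h']) h
    rw [this]
    simp only [List.mem_cons, exists_eq_or_imp]
    tauto

theorem mem_incoming (v : Fin n) (p : Fin n × ℝ) :
    p ∈ (incoming deg edge).val v ↔ ∃ k, edge p.1 k = (v, p.2) := by
  have h (L : List (Fin n)) (f : Fin n → List (Fin n × ℝ)) :
      p ∈ L.foldl (fun f i => (List.finRange (deg i)).foldl (appendEdge deg edge i) f) f v ↔
        p ∈ f v ∨ (p.1 ∈ L ∧ ∃ k, edge p.1 k = (v, p.2)) := by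
    induction L generalizing f with
    | nil => simp
    | cons i L ih =>
      rw [List.foldl_cons, ih, mem_foldl_appendEdge, List.mem_cons]
      constructor
      · rintro ((h | ⟨rfl, k, -, hk⟩) | ⟨h1, h2⟩)
        · exact Or.inl h
        · exact Or.inr ⟨Or.inl rfl, k, hk⟩
        · exact Or.inr ⟨Or.inr h1, h2⟩
      · rintro (h | ⟨rfl | h, k, hk⟩)
        · exact Or.inl (Or.inl h)
        · exact Or.inl (Or.inr ⟨rfl, k, List.mem_finRange k, hk⟩)
        · exact Or.inr ⟨h, k, hk⟩
  rw [incoming_val, h]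
  simp

theorem sum_length_appendEdge (i : Fin n) (f : Fin n → List (Fin n × ℝ)) (k : Fin (deg i)) :
    ∑ v, (appendEdge deg edge i f k v).length = ∑ v, (f v).length + 1 := by
  have h (v : Fin n) : (appendEdge deg edge i f k v).length =
      (f v).length + if v = (edge i k).1 then 1 else 0 := by
    rw [appendEdge, Function.update_apply]
    split_ifs with h
    · rw [List.length_append, h]; rfl
    · rfl
  rw [Finset.sum_congr rfl fun v _ => h v, Finset.sum_add_distrib]
  simp

/-- Every edge is appended to exactly one list. The search domains of a pass thus have total size
`E`, which is what Cauchy–Schwarz is applied to. -/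
theorem sum_length_incoming :
    ∑ v, ((incoming deg edge).val v).length = ∑ i, deg i := by
  have h1 (i : Fin n) (K : List (Fin (deg i))) (f : Fin n → List (Fin n × ℝ)) :
      ∑ v, (K.foldl (appendEdge deg edge i) f v).length = ∑ v, (f v).length + K.length := by
    induction K generalizing f with
    | nil => simp
    | cons k K ih => rw [List.foldl_cons, ih, sum_length_appendEdge, List.length_cons]; ring
  have h2 (L : List (Fin n)) (f : Fin n → List (Fin n × ℝ)) :
      ∑ v, (L.foldl (fun f i => (List.finRange (deg i)).foldl (appendEdge deg edge i) f) f
        v).length = ∑ v, (f v).length + (L.map deg).sum := by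
    induction L generalizing f with
    | nil => simp
    | cons i L ih =>
      rw [List.foldl_cons, ih, h1, List.length_finRange, List.map_cons, List.sum_cons, add_assoc]
  rw [incoming_val, h2, ← List.ofFn_eq_map, List.sum_ofFn]
  simp

theorem WGraph.EdgeList.sum_deg {G : WGraph n} (L : G.EdgeList) : ∑ i, L.deg i = G.numEdges := by
  classical
  rw [WGraph.numEdges, Finset.card_filter, Fintype.sum_prod_type]
  refine Finset.sum_congr rfl fun i _ => ?_
  rw [← Finset.card_filter]
  have : (Finset.univ.filter fun j => (G.weight i j).isSome = true) =
      Finset.univ.image fun k => (L.edge i k).1 := by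
    ext j
    rw [Finset.mem_filter, Option.isSome_iff_exists, Finset.mem_image]
    simp only [Finset.mem_univ, true_and, L.weight_eq_some_iff]
    constructor
    · rintro ⟨ℓ, k, hk⟩
      exact ⟨k, by rw [hk]⟩
    · rintro ⟨k, rfl⟩
      exact ⟨_, k, rfl⟩
  simp only [this]
  rw [Finset.card_image_of_injective _ (L.dest_injective i), Finset.card_fin]

theorem WGraph.numEdges_le (G : WGraph n) : G.numEdges ≤ n ^ 2 := by
  refine (Finset.card_le_univ _).trans ?_
  simp [sq]

theorem WGraph.EdgeList.mem_incoming_iff {G : WGraph n} (L : G.EdgeList) (i j : Fin n) (ℓ : ℝ) :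
    (j, ℓ) ∈ (incoming L.deg L.edge).val i ↔ G.weight j i = some ℓ := by
  rw [mem_incoming, L.weight_eq_some_iff]

end Incoming

/-! ### Parameters -/

section Parameters

variable {n : ℕ} {ε : ℝ}

theorem one_lt_sq_div (hn : 1 ≤ n) (h0 : 0 < ε) (h1 : ε < 1) : 1 < (n : ℝ) ^ 2 / ε := by
  rw [lt_div_iff₀ h0, one_mul]
  have : (1 : ℝ) ≤ n := by exact_mod_cast hn
  nlinarith

theorem union_bound (hn : 1 ≤ n) (h0 : 0 < ε) {k : ℕ} (hk : k ≤ n) :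
    (n : ℝ≥0∞) * (k * ENNReal.ofReal (1 / ((n : ℝ) ^ 2 / ε))) ≤ ENNReal.ofReal ε := by
  have hn' : (0 : ℝ) < n := by exact_mod_cast hn
  calc _ ≤ (n : ℝ≥0∞) * (n * ENNReal.ofReal (1 / ((n : ℝ) ^ 2 / ε))) := by gcongr
    _ = ENNReal.ofReal (n * (n * (1 / ((n : ℝ) ^ 2 / ε)))) := by
      rw [ENNReal.ofReal_mul hn'.le, ENNReal.ofReal_mul hn'.le, ENNReal.ofReal_natCast]
    _ = _ := by
      congr 1
      field_simp

theorem one_le_logb {n : ℕ} (hn : 2 ≤ n) : 1 ≤ Real.logb 2 n := by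
  have : (2 : ℝ) ≤ n := by exact_mod_cast hn
  rw [Real.le_logb_iff_rpow_le (by norm_num) (by linarith), Real.rpow_one]
  exact this

/-- The factor `n²` contributes `2 lg n`, the assumption on `ε` at most `|c| lg n`, and rounding up
at most `1 ≤ lg n`. -/
theorem exactSearches_le_logb {c : ℝ} (hn : 2 ≤ n) (h0 : 0 < ε) (h1 : ε < 1)
    (hc : ε⁻¹ ≤ (n : ℝ) ^ c) (N : ℕ) :
    (exactSearches N ((n : ℝ) ^ 2 / ε) : ℝ) ≤ (3 + |c|) * Real.logb 2 n := by
  have hn' : (0 : ℝ) < n := by positivity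
  have hl := one_le_logb hn
  have h2 : Real.logb 2 ((n : ℝ) ^ 2 / ε) ≤ (2 + |c|) * Real.logb 2 n := by
    rw [div_eq_mul_inv, Real.logb_mul (by positivity) (by positivity), Real.logb_pow]
    have : Real.logb 2 ε⁻¹ ≤ c * Real.logb 2 n := by
      rw [← Real.logb_rpow_eq_mul_logb_of_pos hn']
      exact Real.logb_le_logb_of_le (by norm_num) (by positivity) hc
    have h3 : c * Real.logb 2 n ≤ |c| * Real.logb 2 n := by gcongr; exact le_abs_self c
    push_cast
    linarith
  have h3 : 0 ≤ Real.logb 2 ((n : ℝ) ^ 2 / ε) :=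
    Real.logb_nonneg (by norm_num) (one_lt_sq_div (by omega) h0 h1).le
  have h4 := Nat.ceil_lt_add_one h3
  have h5 : (exactSearches N ((n : ℝ) ^ 2 / ε) : ℝ) ≤ ⌈Real.logb 2 ((n : ℝ) ^ 2 / ε)⌉₊ := by
    exact_mod_cast min_le_right _ _
  linarith

theorem ofReal_one_sub_le_prob {α : Type} {p : QProg α} {A : Set α} (h0 : 0 < ε)
    (h : p.prob Aᶜ ≤ ENNReal.ofReal ε) : ENNReal.ofReal (1 - ε) ≤ p.prob A := by
  rw [ENNReal.ofReal_sub _ h0.le, ENNReal.ofReal_one]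
  exact QProg.one_sub_le_prob h

theorem natCast_add_mul_ofReal (k n : ℕ) {y : ℝ} (hy : 0 ≤ y) :
    (k : ℝ≥0∞) + n * (1 + ENNReal.ofReal y) = ENNReal.ofReal (k + n * (1 + y)) := by
  rw [ENNReal.ofReal_add (by positivity) (by positivity), ENNReal.ofReal_mul (by positivity),
    ENNReal.ofReal_add zero_le_one hy, ENNReal.ofReal_natCast, ENNReal.ofReal_natCast,
    ENNReal.ofReal_one]

end Parameters

/-! ### The matrix model -/

section Matrix

variable {n : ℕ}

/-- The source and the length of the candidate edge from `j` to `i`. -/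
noncomputable def matrixCandidate (query : Fin n → Fin n → Option ℝ) (i j : Fin n) :
    Timed (Fin n × WithTop ℝ) :=
  ⟨(j, (query j i).elim ⊤ fun ℓ => (ℓ : WithTop ℝ)), 2⟩

theorem matrixCandidate_val_eq_iff {G : WGraph n} {i j : Fin n} {ℓ : ℝ} :
    G.weight j i = some ℓ ↔ ∃ x, (matrixCandidate G.weight i x).val = (j, (ℓ : WithTop ℝ)) := by
  constructor
  · intro h
    exact ⟨j, by rw [matrixCandidate, h]; rfl⟩
  · rintro ⟨x, hx⟩
    rw [matrixCandidate, Prod.mk.injEq] at hx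
    obtain ⟨rfl, hx⟩ := hx
    cases hw : G.weight x i with
    | none => rw [hw] at hx; exact absurd hx WithTop.top_ne_coe
    | some y => rw [hw] at hx; rw [WithTop.coe_injective hx]

variable [NeZero n]

theorem spnwMatrix_eq (query : Fin n → Fin n → Option ℝ) (a : Fin n) (ε : ℝ) :
    spnwMatrix query a ε = bellmanFord
      (fun i S => relax (matrixCandidate query i) ((n : ℝ) ^ 2 / ε) i S) (List.finRange n) a := by
  unfold spnwMatrix
  congr 1
  funext i S
  congr 1
  funext j
  rw [matrixCandidate]
  cases query j i <;> rfl

variable (G : WGraph n) (a : Fin n) {ε : ℝ}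

theorem ofReal_le_prob_spnwMatrix (h0 : 0 < ε) (h1 : ε < 1) :
    ENNReal.ofReal (1 - ε) ≤ (spnwMatrix G.weight a ε).prob {r | G.Correct a r} := by
  have hn : 1 ≤ n := NeZero.pos n
  refine ofReal_one_sub_le_prob h0 ?_
  rw [spnwMatrix_eq]
  exact (prob_bellmanFord_le a (fun i _ _ _ => List.mem_finRange i) fun S i _ =>
    prob_relax_le (one_lt_sq_div hn h0 h1) (fun _ _ => matrixCandidate_val_eq_iff) S).trans
      (union_bound hn h0 (List.length_finRange).le)

theorem expectedTime_spnwMatrix_le {c : ℝ} (hn : 2 ≤ n) (h0 : 0 < ε) (h1 : ε < 1)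
    (hc : ε⁻¹ ≤ (n : ℝ) ^ c) : (spnwMatrix G.weight a ε).expectedTime ≤
      ENNReal.ofReal ((7 + 13221 * √(3 + |c|)) * √((n : ℝ) ^ 5 * Real.logb 2 n)) := by
  rw [spnwMatrix_eq]
  have hε := one_lt_sq_div (by omega : 1 ≤ n) h0 h1
  refine (expectedTime_bellmanFord_le a fun S i _ =>
    expectedTime_relax_le (cand := matrixCandidate G.weight i) (fun x => le_rfl) hε i S).trans ?_
  rw [List.map_const', List.sum_replicate, List.length_finRange, nsmul_eq_mul]
  have ht := exactSearches_le_logb hn h0 h1 hc n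
  have hl := one_le_logb hn
  set t₀ := exactSearches n ((n : ℝ) ^ 2 / ε)
  have hn' : (1 : ℝ) ≤ n := by exact_mod_cast (by omega : 1 ≤ n)
  set X := √((n : ℝ) ^ 5 * Real.logb 2 n) with hX
  have hX2 : (n : ℝ) ^ 2 * √(n * Real.logb 2 n) = X := by
    rw [hX, show (n : ℝ) ^ 5 * Real.logb 2 n = (n ^ 2) ^ 2 * (n * Real.logb 2 n) by ring,
      Real.sqrt_mul (x := ((n : ℝ) ^ 2) ^ 2) (by positivity), Real.sqrt_sq (by positivity)]
  have hX3 : (n : ℝ) ^ 2 ≤ X := by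
    rw [← hX2]
    refine le_mul_of_one_le_right (by positivity) (Real.one_le_sqrt.2 ?_)
    nlinarith
  -- This is the cost of one relaxation; `n²` of them give `X`, and the bookkeeping is `O(n²)`,
  -- covered by `hX3`.
  have hQ : √((n : ℝ) * t₀) ≤ √(3 + |c|) * √(n * Real.logb 2 n) := by
    rw [← Real.sqrt_mul (by positivity)]
    refine Real.sqrt_le_sqrt ?_
    rw [mul_left_comm]
    gcongr
  calc _ = ENNReal.ofReal ((2 * n + 2 : ℕ) + n * (1 + ((0 : ℕ) + n * (1 + 13221 *
          √(n * t₀))))) := by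
        rw [← natCast_add_mul_ofReal _ _ (by positivity), ← natCast_add_mul_ofReal _ _ (by positivity),
          Nat.cast_zero, zero_add]
    _ ≤ _ := by
        refine ENNReal.ofReal_le_ofReal ?_
        have : (n : ℝ) ^ 2 * √((n : ℝ) * t₀) ≤ √(3 + |c|) * X := by
          rw [← hX2, mul_left_comm]
          gcongr
        push_cast
        nlinarith

end Matrix

/-! ### The edge list model -/

section Edges

variable {n : ℕ} {G : WGraph n} (L : G.EdgeList) (a : Fin n) {ε : ℝ}

theorem ofReal_le_prob_spnwEdgeList (h0 : 0 < ε) (h1 : ε < 1) :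
    ENNReal.ofReal (1 - ε) ≤ (spnwEdgeList L.deg L.edge a ε).prob {r | G.Correct a r} := by
  have hn : 1 ≤ n := a.pos
  refine ofReal_one_sub_le_prob h0 ?_
  have hmem := L.mem_incoming_iff
  rw [spnwEdgeList, QProg.prob_run_bind, QProg.prob_run_bind]
  set f := (incoming L.deg L.edge).val
  refine (prob_bellmanFord_le (G := G) a (fun i j ℓ hw => ?_) fun S i hi => ?_).trans
      (union_bound hn h0 ((List.length_filter_le _ _).trans (List.length_finRange).le))
  · rw [List.mem_filter, decide_eq_true_iff]
    exact ⟨List.mem_finRange i, List.length_pos_of_mem ((hmem i j ℓ).2 hw) |>.ne'⟩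
  · rw [List.mem_filter, decide_eq_true_iff] at hi
    rw [dif_neg hi.2]
    have : NeZero (f i).length := ⟨hi.2⟩
    refine prob_relax_le (one_lt_sq_div hn h0 h1) (fun j ℓ => ?_) S
    rw [← hmem, List.mem_iff_get]
    refine exists_congr fun x => ?_
    change _ ↔ (((f i).get x).1, (((f i).get x).2 : WithTop ℝ)) = _
    rw [Prod.ext_iff, Prod.ext_iff]
    exact and_congr Iff.rfl WithTop.coe_inj.symm

/-- Cauchy–Schwarz; it turns the cost `∑ √dᵢ` of a pass over the in-degrees into `√(n E)`. -/
theorem sum_sqrt_le {ι : Type} (s : Finset ι) (d : ι → ℕ) :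
    ∑ i ∈ s, √(d i : ℝ) ≤ √(s.card * (∑ i ∈ s, d i : ℕ)) := by
  refine Real.le_sqrt_of_sq_le ?_
  refine (sq_sum_le_card_mul_sum_sq).trans (le_of_eq ?_)
  rw [Finset.sum_congr rfl fun i _ => Real.sq_sqrt (Nat.cast_nonneg (d i))]
  push_cast
  rfl

theorem expectedTime_spnwEdgeList_le {c : ℝ} (hn : 2 ≤ n) (hE : 1 ≤ G.numEdges) (h0 : 0 < ε)
    (h1 : ε < 1) (hc : ε⁻¹ ≤ (n : ℝ) ^ c) : (spnwEdgeList L.deg L.edge a ε).expectedTime ≤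
      ENNReal.ofReal ((12 + 13221 * √(3 + |c|)) *
        √((n : ℝ) ^ 3 * G.numEdges * Real.logb 2 n)) := by
  rw [spnwEdgeList, QProg.expectedTime_run_bind, QProg.expectedTime_run_bind, incoming_time,
    L.sum_deg]
  have hlen := sum_length_incoming L.deg L.edge
  rw [L.sum_deg] at hlen
  set f := (incoming L.deg L.edge).val
  set m := G.numEdges with hm
  have hl := one_le_logb hn
  have hn' : (1 : ℝ) ≤ n := by exact_mod_cast (by omega : 1 ≤ n)
  have hm' : (1 : ℝ) ≤ m := by exact_mod_cast hE
  have hmn : (m : ℝ) ≤ n ^ 2 := by exact_mod_cast G.numEdges_le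
  set K := 1 + 13221 * √((3 + |c|) * Real.logb 2 n) with hK
  have h := expectedTime_bellmanFord_le a
    (relaxAt := fun i S =>
      if h : (f i).length = 0 then pure S
      else
        haveI : NeZero (f i).length := ⟨h⟩
        relax (N := (f i).length)
          (fun x => Timed.op (((f i).get x).1, (((f i).get x).2 : WithTop ℝ)))
          ((n : ℝ) ^ 2 / ε) i S)
    (L := (List.finRange n).filter fun i => decide ((f i).length ≠ 0))
    (b := fun i => ENNReal.ofReal
      (13221 * √((f i).length * exactSearches (f i).length ((n : ℝ) ^ 2 / ε))))
    (fun S i hi => by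
      rw [List.mem_filter, decide_eq_true_iff] at hi
      rw [dif_neg hi.2]
      have : NeZero (f i).length := ⟨hi.2⟩
      exact expectedTime_relax_le (fun x => one_le_two) (one_lt_sq_div (by omega) h0 h1) i S)
  refine (add_le_add le_rfl (add_le_add le_rfl h)).trans ?_
  have hsum : (((List.finRange n).filter fun i => decide ((f i).length ≠ 0)).map fun i =>
      1 + ENNReal.ofReal (13221 *
        √((f i).length * exactSearches (f i).length ((n : ℝ) ^ 2 / ε)))).sum ≤
      ENNReal.ofReal (K * √(n * m)) := by
    rw [← List.sum_toFinset _ ((List.nodup_finRange n).filter _)]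
    refine (Finset.sum_le_sum (g := fun i => ENNReal.ofReal (K * √((f i).length : ℝ)))
      fun i hi => ?_).trans ?_
    · rw [List.mem_toFinset, List.mem_filter, decide_eq_true_iff] at hi
      have hd : (1 : ℝ) ≤ (f i).length := by exact_mod_cast Nat.one_le_iff_ne_zero.2 hi.2
      rw [← ENNReal.ofReal_one, ← ENNReal.ofReal_add zero_le_one (by positivity)]
      refine ENNReal.ofReal_le_ofReal ?_
      have e1 := Real.one_le_sqrt.2 hd
      have e2 : √(((f i).length : ℝ) * exactSearches (f i).length ((n : ℝ) ^ 2 / ε)) ≤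
          √((3 + |c|) * Real.logb 2 n) * √((f i).length : ℝ) := by
        rw [mul_comm, ← Real.sqrt_mul (by positivity)]
        refine Real.sqrt_le_sqrt ?_
        gcongr
        exact exactSearches_le_logb hn h0 h1 hc _
      rw [hK, add_mul, one_mul, mul_assoc]
      gcongr
    · refine (Finset.sum_le_sum_of_subset (Finset.subset_univ _)).trans ?_
      rw [← ENNReal.ofReal_sum_of_nonneg fun _ _ => by positivity, ← Finset.mul_sum]
      refine ENNReal.ofReal_le_ofReal ?_
      gcongr
      have := sum_sqrt_le Finset.univ fun i => (f i).length
      rwa [hlen, Finset.card_fin] at this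
  set X := √((n : ℝ) ^ 3 * m * Real.logb 2 n) with hX
  have hX1 : (n : ℝ) * √(n * m) * √(Real.logb 2 n) = X := by
    rw [hX, show (n : ℝ) ^ 3 * m * Real.logb 2 n = n ^ 2 * (n * m) * Real.logb 2 n by ring,
      Real.sqrt_mul (x := (n : ℝ) ^ 2 * (n * m)) (by positivity),
      Real.sqrt_mul (x := (n : ℝ) ^ 2) (by positivity),
      Real.sqrt_sq (by positivity)]
  have hl' : 1 ≤ √(Real.logb 2 n) := Real.one_le_sqrt.2 hl
  have hX2 : (n : ℝ) * √(n * m) ≤ X := by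
    rw [← hX1]; exact le_mul_of_one_le_right (by positivity) hl'
  -- Here at least one edge is needed: the initialization takes linear time in `n` in any case.
  have hX3 : (n : ℝ) ≤ X := by
    refine le_trans (le_mul_of_one_le_right (by positivity) (Real.one_le_sqrt.2 ?_)) hX2
    nlinarith
  -- Setting up the incoming lists costs `O(E)`, which is dominated because `E ≤ n²`.
  have hX4 : (m : ℝ) ≤ X := by
    refine Real.le_sqrt_of_sq_le ?_
    calc (m : ℝ) ^ 2 = m * m := sq _
      _ ≤ n ^ 2 * m := by gcongr
      _ ≤ n ^ 3 * m := by gcongr; norm_num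
      _ ≤ n ^ 3 * m * Real.logb 2 n := le_mul_of_one_le_right (by positivity) hl
  calc _ ≤ ((2 * n + 2 * m : ℕ) : ℝ≥0∞) + (((n : ℕ) : ℝ≥0∞) + (((2 * n + 2 : ℕ) : ℝ≥0∞) +
        n * (1 + ENNReal.ofReal (K * √(n * m))))) := by
        refine add_le_add le_rfl (add_le_add le_rfl (add_le_add le_rfl ?_))
        gcongr
    _ = ENNReal.ofReal ((2 * n + 2 * m + n + (2 * n + 2) : ℕ) + n * (1 + K * √(n * m))) := by
        rw [← add_assoc, ← Nat.cast_add, ← add_assoc, ← Nat.cast_add,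
          natCast_add_mul_ofReal _ _ (by positivity)]
    _ ≤ _ := by
        refine ENNReal.ofReal_le_ofReal ?_
        push_cast
        have e : (n : ℝ) * (K * √(n * m)) = n * √(n * m) + 13221 * (√(3 + |c|) * X) := by
          rw [hK, Real.sqrt_mul (by positivity), ← hX1]
          ring
        linarith

end Edges

end QSP

theorem theorem7 :
    -- Adjacency matrix model: correctness with probability at least `1 - ε`
    (∀ (n : ℕ) [NeZero n] (G : QSP.WGraph n) (a : Fin n) (ε : ℝ), 0 < ε → ε < 1 →
      ENNReal.ofReal (1 - ε) ≤
        (QSP.spnwMatrix G.weight a ε).prob {r | G.Correct a r}) ∧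
    -- Adjacency matrix model: expected running time `O(√(V⁵ lg V))`, for `ε⁻¹` polynomial in `V`
    (∀ c : ℝ, ∃ C : ℝ, ∀ (n : ℕ) [NeZero n] (G : QSP.WGraph n) (a : Fin n) (ε : ℝ),
      2 ≤ n → 0 < ε → ε < 1 → ε⁻¹ ≤ (n : ℝ) ^ c →
      (QSP.spnwMatrix G.weight a ε).expectedTime ≤
        ENNReal.ofReal (C * √((n : ℝ) ^ 5 * Real.logb 2 n))) ∧
    -- Edge list model: correctness with probability at least `1 - ε`
    (∀ (n : ℕ) (G : QSP.WGraph n) (L : G.EdgeList) (a : Fin n) (ε : ℝ), 0 < ε → ε < 1 →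
      ENNReal.ofReal (1 - ε) ≤
        (QSP.spnwEdgeList L.deg L.edge a ε).prob {r | G.Correct a r}) ∧
    -- Edge list model: expected running time `O(√(V³E lg V))`, for `ε⁻¹` polynomial in `V`
    (∀ c : ℝ, ∃ C : ℝ, ∀ (n : ℕ) (G : QSP.WGraph n) (L : G.EdgeList) (a : Fin n) (ε : ℝ),
      2 ≤ n → 1 ≤ G.numEdges → 0 < ε → ε < 1 → ε⁻¹ ≤ (n : ℝ) ^ c →
      (QSP.spnwEdgeList L.deg L.edge a ε).expectedTime ≤
        ENNReal.ofReal (C * √((n : ℝ) ^ 3 * G.numEdges * Real.logb 2 n))) := by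
  refine ⟨fun n _ G a ε h0 h1 => QSP.ofReal_le_prob_spnwMatrix G a h0 h1,
    -- The constant is found by unification with the explicit bound, so it can depend on `c` only.
    fun c => ⟨_, fun n _ G a ε hn h0 h1 hc => QSP.expectedTime_spnwMatrix_le G a hn h0 h1 hc⟩,
    fun n G L a ε h0 h1 => QSP.ofReal_le_prob_spnwEdgeList L a h0 h1,
    fun c => ⟨_, fun n G L a ε hn hE h0 h1 hc =>
      QSP.expectedTime_spnwEdgeList_le L a hn hE h0 h1 hc⟩⟩
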